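/- Let $k\in\mathbb N$. Let $\mathcal P^{(k)}$ be the space of partitions of $\mathbb N$ with at most $k$ blocks, and $\mathcal P^{(k)}_{[n]}$ the set of partitions of $[n]=\{1,\dots,n\}$ with at most $k$ blocks; $B_{|A}$ denotes the restriction of a partition $B$ to $A$, and $\#B$ its number of blocks. Equip $\mathcal P^{(k)}$ with the metric $d(\pi,\pi')=1/\max\{n:\pi_{|[n]}=\pi'_{|[n]}\}$ ($d(\pi,\pi)=0$) and the $\sigma$-algebra generated by the restrictions $B\mapsto B_{|[n]}$, $n\ge 1$. Let $\nu$ be a probability measure on the ranked simplex $\{s\in\mathbb R^k: s_1\ge\dots\ge s_k\ge 0,\ \sum_i s_i=1\}$. For $s$ in this simplex let $\varrho_s$ be the law of the random partition of $\mathbb N$ given by $i\sim j\iff X_i=X_j$, where $X_1,X_2,\dots$ are i.i.d. with $\mathbb P(X_i=j)=s_j$, and put $\varrho_\nu=\int\varrho_s\,\nu(ds)$. For a partition $\pi$ of a finite set $b\subset\mathbb N$ write $\varrho_\nu(\pi)=\varrho_\nu(\{C: C_{|b}=\pi\})$. For $n\in\mathbb N$ and $B,B'\in\mathcal P^{(k)}_{[n]}$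 put $$p_n(B,B';\nu)=\frac{k!}{(k-\#B')!}\prod_{b\in B}\frac{(k-\#B'_{|b})!}{k!}\,\varrho_\nu(B'_{|b}).$$ Let $\lambda>0$. Theorem. There exists a Markov transition semigroup on $\mathcal P^{(k)}$ such that for every initial distribution $\mu_0$ on $\mathcal P^{(k)}$ there is a time-homogeneous Markov process $(B(t),t\ge 0)$ on $\mathcal P^{(k)}$ with this semigroup, with $B(0)\sim\mu_0$ and with càdlàg paths, such that for every $n$ the restriction $(B(t)_{|[n]},t\ge0)$ is a Markov process on $\mathcal P^{(k)}_{[n]}$ with jump rates $q_n(B,B';\nu)=\lambda\,p_n(B,B';\nu)$ for $B\ne B'$, i.e. with $Q$-matrix $$Q_n^\nu(B,B')=\begin{cases}\lambda\,p_n(B,B';\nu), & B\neq B',\\ \lambda\,(p_n(B,B;\nu)-1), & B=B'.\end{cases}$$ -/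

import Mathlib

open MeasureTheory ProbabilityTheory Filter Topology
open scoped NNReal ENNReal Nat

/-- Set partitions of `α` with at most `k` blocks; a partition is its equivalence relation, and its
blocks are the equivalence classes. The natural numbers are labelled from `0`, so that
`PartitionK ℕ k` is `𝒫⁽ᵏ⁾` and `PartitionK (Fin n) k` is the set of partitions of the first `n`
labels with at most `k` blocks. -/
def PartitionK (α : Type*) (k : ℕ) : Type _ :=
  {B : Setoid α // B.classes.encard ≤ k}

namespace PartitionK

variable {α β : Type*} {k : ℕ}

/-- The blocks of a partition. -/
def blocks (B : PartitionK α k) : Set (Set α) := B.1.classes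

/-- The number of blocks `#B`. -/
noncomputable def numBlocks (B : PartitionK α k) : ℕ := B.blocks.ncard

theorem encard_classes_eq {γ : Type*} (r : Setoid γ) :
    r.classes.encard = ENat.card (Quotient r) :=
  (ENat.card_congr (Setoid.quotientEquivClasses r)).symm

theorem encard_classes_comap_le (f : β → α) (B : Setoid α) :
    (Setoid.comap f B).classes.encard ≤ B.classes.encard := by
  rw [encard_classes_eq, encard_classes_eq, ← Set.encard_univ, ← Set.encard_univ]
  have hf : Function.Injective (Quotient.map' (s₁ := Setoid.comap f B) (s₂ := B) f
      (fun _ _ hab => hab)) := by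
    rintro ⟨a⟩ ⟨b⟩ hab
    exact Quotient.sound' (show B (f a) (f b) from Quotient.eq''.1 hab)
  exact Set.encard_le_encard_of_injOn (fun _ _ => Set.mem_univ _) hf.injOn

/-- Pull-back of a partition along a map; along the inclusion of a subset `A` this is the
restriction of the partition to `A`. -/
def comap (f : β → α) (B : PartitionK α k) : PartitionK β k :=
  ⟨Setoid.comap f B.1, (encard_classes_comap_le f B.1).trans B.2⟩

/-- The restriction `B_{|[n]}` of a partition of `ℕ` to its first `n` elements. -/
def restrict (n : ℕ) (B : PartitionK ℕ k) : PartitionK (Fin n) k :=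
  B.comap Fin.val

/-- The restriction `B_{|b}` of a partition to a subset `b`. -/
def restrictTo (B : PartitionK α k) (b : Set α) : PartitionK b k :=
  B.comap Subtype.val

theorem encard_classes_ker_le (X : α → Fin k) : (Setoid.ker X).classes.encard ≤ k := by
  rw [encard_classes_eq]
  refine (ENat.card_le_card_of_injective (Setoid.kerLift_injective X)).trans ?_
  simp

/-- The partition `Π(X)` generated by the colours `X`: `i ∼ j` if and only if `X i = X j`. -/
def ofColours (X : α → Fin k) : PartitionK α k :=
  ⟨Setoid.ker X, encard_classes_ker_le X⟩

/-- Every set of partitions of the finite set of the first `n` labels is measurable. -/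
instance measurableSpaceFin (n k : ℕ) : MeasurableSpace (PartitionK (Fin n) k) := ⊤

/-- The `σ`-algebra on `𝒫⁽ᵏ⁾` generated by the restrictions to the first `n` labels, for all `n`. -/
instance measurableSpaceNat (k : ℕ) : MeasurableSpace (PartitionK ℕ k) :=
  ⨆ n : ℕ, MeasurableSpace.comap (restrict n) ⊤

/-- The coarsest topology on `𝒫⁽ᵏ⁾` for which all restrictions to finite sets (with the discrete
topology) are continuous, that is, the topology of the metric
`d(π, π') = 1 / max {n | π_{|[n]} = π'_{|[n]}}`. -/
instance topologicalSpaceNat (k : ℕ) : TopologicalSpace (PartitionK ℕ k) :=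
  ⨅ n : ℕ, TopologicalSpace.induced (restrict n) ⊥

theorem measurable_restrict (n : ℕ) :
    Measurable (restrict n : PartitionK ℕ k → PartitionK (Fin n) k) :=
  Measurable.of_comap_le (le_iSup (fun n : ℕ => MeasurableSpace.comap (restrict (k := k) n) ⊤) n)

theorem measurable_ofColours :
    Measurable (ofColours : (ℕ → Fin k) → PartitionK ℕ k) := by
  have h : ∀ n : ℕ, Measurable (fun X : ℕ → Fin k => restrict n (ofColours X)) := fun n =>
    Measurable.comp (g := (ofColours : (Fin n → Fin k) → PartitionK (Fin n) k))
      (f := fun (X : ℕ → Fin k) (i : Fin n) => X i) (measurable_of_finite _) (by fun_prop)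
  refine measurable_iff_comap_le.2 ?_
  rw [measurableSpaceNat, MeasurableSpace.comap_iSup]
  refine iSup_le fun n => ?_
  rw [MeasurableSpace.comap_comp]
  exact measurable_iff_comap_le.1 (h n)

end PartitionK

/-- The ranked `k`-simplex: `s₁ ≥ s₂ ≥ … ≥ s_k ≥ 0` with `s₁ + ⋯ + s_k = 1`, with its Borel
`σ`-algebra. -/
abbrev RankedSimplex (k : ℕ) : Type :=
  {s : Fin k → ℝ // Antitone s ∧ (∀ j, 0 ≤ s j) ∧ ∑ j, s j = 1}

/-- The distribution on the colours `1, …, k` that gives mass `s_j` to colour `j`. -/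
noncomputable def colourLaw {k : ℕ} (s : RankedSimplex k) : PMF (Fin k) :=
  PMF.ofFintype (fun j => ENNReal.ofReal (s.1 j)) (by
    rw [← ENNReal.ofReal_sum_of_nonneg fun j _ => s.2.2.1 j, s.2.2.2, ENNReal.ofReal_one])

/-- The paintbox `ϱ_s`: the law of `Π(X)` for i.i.d. colours `X₁, X₂, …` with law `s`. -/
noncomputable def paintbox {k : ℕ} (s : RankedSimplex k) : Measure (PartitionK ℕ k) :=
  (Measure.infinitePi fun _ : ℕ => (colourLaw s).toMeasure).map PartitionK.ofColours

/-- The probability `ϱ_ν(E) = ∫ ϱ_s(E) ν(ds)` of an event under the paintbox based on `ν`. -/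
noncomputable def paintboxMix {k : ℕ} (ν : Measure (RankedSimplex k)) (E : Set (PartitionK ℕ k)) :
    ℝ≥0∞ :=
  ∫⁻ s, paintbox s E ∂ν

/-- `ϱ_ν(π)` for a partition `π` of a subset `b` of the first `n` labels: the probability that the
restriction to `b` of the paintbox based on `ν` is `π`. -/
noncomputable def paintboxProb {k n : ℕ} (ν : Measure (RankedSimplex k)) (b : Set (Fin n))
    (π : PartitionK b k) : ℝ :=
  (paintboxMix ν {C : PartitionK ℕ k | (C.restrict n).restrictTo b = π}).toReal

/-- The transition probabilities
`p_n(B, B'; ν) = k! / (k - #B')! * ∏_{b ∈ B} (k - #B'_{|b})! / k! * ϱ_ν(B'_{|b})`. -/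
noncomputable def transProb {k : ℕ} (ν : Measure (RankedSimplex k)) (n : ℕ)
    (B B' : PartitionK (Fin n) k) : ℝ :=
  ((k ! : ℝ) / ((k - B'.numBlocks)! : ℝ)) *
    ∏ᶠ b ∈ B.blocks,
      (((k - (B'.restrictTo b).numBlocks)! : ℝ) / (k ! : ℝ)) * paintboxProb ν b (B'.restrictTo b)

open Classical in
/-- The `Q`-matrix with jump rates `q_n(B, B') = lam * p_n(B, B'; ν)` for `B ≠ B'`, and diagonal
entries `lam * (p_n(B, B; ν) - 1)`. -/
noncomputable def rateMatrix {k : ℕ} (lam : ℝ) (ν : Measure (RankedSimplex k)) (n : ℕ) :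
    Matrix (PartitionK (Fin n) k) (PartitionK (Fin n) k) ℝ :=
  fun B B' => if B = B' then lam * (transProb ν n B B - 1) else lam * transProb ν n B B'

/-- A time-homogeneous Markov transition semigroup `(P_t)_{t ≥ 0}` on `E`. -/
structure IsMarkovSemigroup {E : Type*} [MeasurableSpace E] (P : ℝ≥0 → Kernel E E) : Prop where
  isMarkovKernel : ∀ t, IsMarkovKernel (P t)
  zero : P 0 = Kernel.id
  add : ∀ s t, P (s + t) = P t ∘ₖ P s

open Classical in
/-- The transition rates of the semigroup are the entries of `Q`:
`P_h(x, {y}) = 1_{x = y} + h * Q(x, y) + o(h)` as `h ↓ 0`. -/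
def HasRates {E : Type*} [MeasurableSpace E] (P : ℝ≥0 → Kernel E E) (Q : Matrix E E ℝ) : Prop :=
  ∀ x y, Tendsto (fun h : ℝ≥0 => ((P h x).real {y} - if x = y then 1 else 0) / (h : ℝ))
    (𝓝[>] 0) (𝓝 (Q x y))

/-- The history `σ(X_r, r ≤ s)` of a process up to time `s`. -/
abbrev history {Ω E : Type*} [MeasurableSpace E] (X : ℝ≥0 → Ω → E) (s : ℝ≥0) : MeasurableSpace Ω :=
  ⨆ r : {r : ℝ≥0 // r ≤ s}, MeasurableSpace.comap (X r) inferInstance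

/-- `X` is a Markov process with transition semigroup `P`:
`ℙ(X_{s+t} ∈ A | X_r, r ≤ s) = P_t(X_s, A)` almost surely. -/
structure IsMarkovProcess {Ω E : Type*} [MeasurableSpace Ω] [MeasurableSpace E]
    (P : ℝ≥0 → Kernel E E) (X : ℝ≥0 → Ω → E) (μ : Measure Ω) : Prop where
  measurable : ∀ t, Measurable (X t)
  markov : ∀ s t : ℝ≥0, ∀ A : Set E, MeasurableSet A →
    μ[(X (s + t) ⁻¹' A).indicator (fun _ => (1 : ℝ)) | history X s]
      =ᵐ[μ] fun ω => (P t (X s ω)).real A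

/-- `X` is a time-homogeneous Markov process on the (finite) state space `E` with
`Q`-matrix `Q`. -/
def IsMarkovProcessWithQMatrix {Ω E : Type*} [MeasurableSpace Ω] [MeasurableSpace E]
    (Q : Matrix E E ℝ) (X : ℝ≥0 → Ω → E) (μ : Measure Ω) : Prop :=
  ∃ P : ℝ≥0 → Kernel E E, IsMarkovSemigroup P ∧ HasRates P Q ∧ IsMarkovProcess P X μ

/-- A càdlàg path: right-continuous with left limits. -/
def IsCadlag {E : Type*} [TopologicalSpace E] (x : ℝ≥0 → E) : Prop :=
  ∀ t, ContinuousWithinAt x (Set.Ici t) t ∧ ∃ l, Tendsto x (𝓝[<] t) (𝓝 l)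

/-! The process is a uniformized chain: at the points of a Poisson process of rate `lam`, a random
map is applied to the current partition. Blocks are named by their least elements, and every name
owns a sequence of colours; after the step, two elements lie together when the colours they read
from the sequences of their old blocks agree (`recolour`). The sequences are independent. Each is
i.i.d. given a colour distribution drawn from `ν`, and its colour names are then permuted uniformly
at random.

This gives the right rates. Exactly `k! / (k - #B')!` colourings generate `B'`. Thanks to the
shuffle, the `k! / (k - #B'_{|b})!` colourings of a block `b` that generate `B'_{|b}` are equally
likely, with total probability `ϱ_ν(B'_{|b})` (`shuffledColours_real`). Multiplying over blocks and
summing over colourings yields the transition probability (`infinitePi_recolour`). A step may leave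
the partition unchanged, so the `Q`-matrix is `lam` times (transition matrix minus identity)
(`hasRates_transition`).

Restrictions stay Markov because the least element of the block of `i` is at most `i`, hence is not
lost in a restriction that keeps `i`. The step thus commutes with restriction (`restrict_recolour`),
and the restricted path is the path of a chain on a finite space driven by the same randomness
(`map_path`).

The Markov property is lack of memory: given the past up to `s`, the residual holding time is again
exponential and the later innovations are fresh (`drivingLaw_age`, `drivingLaw_restart`,
`drivingLaw_markov`). Jump times almost surely do not accumulate (`ae_nonExplosive`), so paths are
step functions. -/

namespace UniformizedChain

/-! ### The continuous-time chain as a function of its driving sequence -/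

variable {E G : Type*}

/-- The discrete chain started from `x` and driven by the innovations `(w 0).1, (w 1).1, …`. -/
def chain (F : E → G → E) (x : E) (w : ℕ → G × ℝ≥0) : ℕ → E
  | 0 => x
  | n + 1 => F (chain F x w n) (w n).1

/-- The time of the `n`-th jump, for the holding times `(w 0).2, (w 1).2, …`. -/
noncomputable def jumpTime (w : ℕ → G × ℝ≥0) (n : ℕ) : ℝ≥0 := ∑ i ∈ Finset.range n, (w i).2

/-- The number of jumps up to time `t` (with value `0` if infinitely many jumps occur). -/
noncomputable def jumpCount (t : ℝ≥0) (w : ℕ → G × ℝ≥0) : ℕ := sInf {n | t < jumpTime w (n + 1)}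

/-- The chain `chain F x w` run in continuous time. -/
noncomputable def path (F : E → G → E) (t : ℝ≥0) (x : E) (w : ℕ → G × ℝ≥0) : E :=
  chain F x w (jumpCount t w)

/-- The first `n` entries of `w`, followed by the sequence `w'`. -/
def glue {M : Type*} (n : ℕ) (w w' : ℕ → M) : ℕ → M := fun i => if i < n then w i else w' (i - n)

/-- Reduce the first holding time by `a`. -/
noncomputable def age (a : ℝ≥0) (w : ℕ → G × ℝ≥0) : ℕ → G × ℝ≥0 :=
  fun i => if i = 0 then ((w 0).1, (w 0).2 - a) else w i

/-- Forget the sequence `w` from index `n` on, and put the constant holding time `c` there. -/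
def freeze (g : G) (c : ℝ≥0) (n : ℕ) (w : ℕ → G × ℝ≥0) : ℕ → G × ℝ≥0 :=
  fun i => if i < n then w i else (g, c)

/-- Exactly `n` jumps occur up to time `s`. -/
def InStage (s : ℝ≥0) (n : ℕ) (w : ℕ → G × ℝ≥0) : Prop :=
  jumpTime w n ≤ s ∧ s < jumpTime w (n + 1)

/-- The jump times are unbounded. -/
def NonExplosive (w : ℕ → G × ℝ≥0) : Prop := ∀ t : ℝ≥0, ∃ n, t < jumpTime w n

/-! ### Deterministic properties of the paths -/

section Pathwise

theorem jumpTime_zero (w : ℕ → G × ℝ≥0) : jumpTime w 0 = 0 := by simp [jumpTime]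

theorem jumpTime_succ (w : ℕ → G × ℝ≥0) (n : ℕ) :
    jumpTime w (n + 1) = jumpTime w n + (w n).2 := by
  simp [jumpTime, Finset.sum_range_succ]

theorem jumpTime_mono (w : ℕ → G × ℝ≥0) : Monotone (jumpTime w) :=
  monotone_nat_of_le_succ fun n => by rw [jumpTime_succ]; exact le_self_add

theorem InStage.jumpCount_eq {s : ℝ≥0} {n : ℕ} {w : ℕ → G × ℝ≥0} (h : InStage s n w) :
    jumpCount s w = n := by
  refine le_antisymm (Nat.sInf_le h.2) (le_csInf ⟨n, h.2⟩ fun m hm => ?_)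
  by_contra! hlt
  exact absurd (hm.trans_le ((jumpTime_mono w hlt).trans h.1)) (lt_irrefl _)

theorem inStage_jumpCount {s : ℝ≥0} {m : ℕ} {w : ℕ → G × ℝ≥0} (h : s < jumpTime w m) :
    InStage s (jumpCount s w) w := by
  have hne : {n | s < jumpTime w (n + 1)}.Nonempty :=
    ⟨m, h.trans_le (jumpTime_mono w (Nat.le_succ m))⟩
  refine ⟨?_, Nat.sInf_mem hne⟩
  by_contra! hlt
  rcases hn : jumpCount s w with _ | j
  · rw [hn, jumpTime_zero] at hlt
    exact absurd hlt (not_lt.2 bot_le)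
  · rw [hn] at hlt
    have : jumpCount s w ≤ j := Nat.sInf_le hlt
    omega

theorem InStage.unique {s : ℝ≥0} {m n : ℕ} {w : ℕ → G × ℝ≥0} (hm : InStage s m w)
    (hn : InStage s n w) : m = n :=
  hm.jumpCount_eq.symm.trans hn.jumpCount_eq

theorem NonExplosive.inStage {w : ℕ → G × ℝ≥0} (h : NonExplosive w) (s : ℝ≥0) :
    InStage s (jumpCount s w) w :=
  inStage_jumpCount (h s).choose_spec

theorem chain_congr (F : E → G → E) (x : E) {w w' : ℕ → G × ℝ≥0} {n : ℕ}
    (h : ∀ i < n, (w i).1 = (w' i).1) : chain F x w n = chain F x w' n := by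
  induction n with
  | zero => rfl
  | succ n ih =>
    rw [chain, chain, ih fun i hi => h i (hi.trans n.lt_succ_self), h n n.lt_succ_self]

theorem chain_add (F : E → G → E) (x : E) (w : ℕ → G × ℝ≥0) (n m : ℕ) :
    chain F x w (n + m) = chain F (chain F x w n) (fun i => w (n + i)) m := by
  induction m with
  | zero => rfl
  | succ m ih => rw [← add_assoc, chain, chain, ih]

theorem jumpTime_congr {w w' : ℕ → G × ℝ≥0} {n : ℕ} (h : ∀ i < n, w i = w' i) :
    jumpTime w n = jumpTime w' n :=
  Finset.sum_congr rfl fun i hi => by rw [h i (Finset.mem_range.1 hi)]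

theorem jumpTime_add (w : ℕ → G × ℝ≥0) (n m : ℕ) :
    jumpTime w (n + m) = jumpTime w n + jumpTime (fun i => w (n + i)) m := by
  simp [jumpTime, Finset.sum_range_add]

theorem jumpTime_age_succ {a : ℝ≥0} {w : ℕ → G × ℝ≥0} (ha : a ≤ (w 0).2) (n : ℕ) :
    jumpTime (age a w) (n + 1) + a = jumpTime w (n + 1) := by
  induction n with
  | zero => simp [jumpTime, age, tsub_add_cancel_of_le ha]
  | succ n ih =>
    rw [jumpTime_succ, jumpTime_succ w, ← ih]
    simp [age]
    ring

theorem chain_age (F : E → G → E) (x : E) (a : ℝ≥0) (w : ℕ → G × ℝ≥0) (n : ℕ) :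
    chain F x (age a w) n = chain F x w n :=
  chain_congr F x fun i _ => by by_cases hi : i = 0 <;> simp [age, hi]

/-- The path after time `s` is the path driven by the remaining innovations. -/
theorem path_add (F : E → G → E) (x : E) {s : ℝ≥0} (t : ℝ≥0) {n : ℕ} {w : ℕ → G × ℝ≥0}
    (hw : NonExplosive w) (h : InStage s n w) :
    path F (s + t) x w
      = path F t (path F s x w) (age (s - jumpTime w n) fun i => w (n + i)) := by
  set a := s - jumpTime w n with ha
  set v := fun i => w (n + i) with hv
  have hsa : jumpTime w n + a = s := add_tsub_cancel_of_le h.1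
  have hav : a ≤ (v 0).2 := by
    have := h.2
    rw [jumpTime_succ, ← hsa] at this
    exact (lt_of_add_lt_add_left this).le
  -- Only positive indices are compared: at index `0` the left side would be `jumpTime w n`, which
  -- may lie strictly before `s`.
  have key : ∀ m, jumpTime w (n + (m + 1)) = s + jumpTime (age a v) (m + 1) := fun m => by
    rw [jumpTime_add, ← hv, ← jumpTime_age_succ hav, ← hsa]
    ring
  obtain ⟨m, hm⟩ := hw (s + t)
  have hm' : t < jumpTime (age a v) (m + 1) := by
    have h1 := hm.trans_le (jumpTime_mono w (show m ≤ n + (m + 1) by omega))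
    rw [key] at h1
    exact lt_of_add_lt_add_left h1
  have hst := inStage_jumpCount hm'
  set j := jumpCount t (age a v) with hj
  have htot : InStage (s + t) (n + j) w := by
    refine ⟨?_, ?_⟩
    · rcases hj' : j with _ | i
      · exact h.1.trans le_self_add
      · rw [key]
        have := hst.1
        rw [hj'] at this
        gcongr
    · rw [add_assoc, key]
      exact add_lt_add_of_le_of_lt le_rfl hst.2
  rw [path, htot.jumpCount_eq, path, path, h.jumpCount_eq, ← hj, chain_age, chain_add]

theorem jumpTime_freeze_of_le {g : G} {c : ℝ≥0} {n m : ℕ} (h : m ≤ n) (w : ℕ → G × ℝ≥0) :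
    jumpTime (freeze g c n w) m = jumpTime w m :=
  jumpTime_congr fun i hi => by simp [freeze, hi.trans_le h]

/-- The path up to time `s` only depends on the first `n` entries of `w`, where `n` is the number
of jumps up to time `s`. -/
theorem path_freeze (F : E → G → E) (x : E) {r s : ℝ≥0} (hrs : r ≤ s) {n : ℕ}
    {w : ℕ → G × ℝ≥0} (h : InStage s n w) (g : G) :
    path F r x (freeze g (s + 1) n w) = path F r x w := by
  have h1 := inStage_jumpCount (hrs.trans_lt h.2)
  set m := jumpCount r w with hm
  have hmn : m ≤ n := Nat.sInf_le (hrs.trans_lt h.2)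
  have h2 : InStage r m (freeze g (s + 1) n w) := by
    refine ⟨(jumpTime_freeze_of_le hmn w).trans_le h1.1, ?_⟩
    rcases hmn.lt_or_eq with hlt | heq
    · rw [jumpTime_freeze_of_le hlt]
      exact h1.2
    -- The frozen holding time `s + 1` exceeds `s`, so no further jump is visible up to time `s`.
    · rw [jumpTime_succ]
      refine (hrs.trans_lt (lt_add_one s)).trans_le ?_
      simp [freeze, heq]
  rw [path, path, h2.jumpCount_eq, ← hm]
  exact chain_congr F x fun i hi => by simp [freeze, hi.trans_le hmn]

theorem jumpCount_mono {w : ℕ → G × ℝ≥0} (hw : NonExplosive w) :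
    Monotone fun t => jumpCount t w := by
  intro r s hrs
  exact Nat.sInf_le (hrs.trans_lt (hw.inStage s).2)

/-- The paths driven by a sequence with unbounded jump times are càdlàg. -/
theorem isCadlag_path [TopologicalSpace E] (F : E → G → E) (x : E) {w : ℕ → G × ℝ≥0}
    (hw : NonExplosive w) : IsCadlag fun t => path F t x w := by
  intro t
  constructor
  · have h := hw.inStage t
    have hev : ∀ᶠ r in 𝓝[Set.Ici t] t, path F r x w = path F t x w := by
      filter_upwards [self_mem_nhdsWithin, mem_nhdsWithin_of_mem_nhds (Iio_mem_nhds h.2)]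
        with r hr1 hr2
      have : InStage r (jumpCount t w) w := ⟨h.1.trans hr1, hr2⟩
      rw [path, this.jumpCount_eq, path]
    exact tendsto_nhds_of_eventually_eq hev
  · rcases eq_or_ne t 0 with rfl | ht
    -- No time precedes `0` in `ℝ≥0`, so the filter is trivial and any limit serves.
    · refine ⟨x, ?_⟩
      simp
    -- The jump counts before `t` are bounded by the count at `t`, so their maximum is attained at
    -- some `r₀ < t`; from `r₀` until `t` the path is constant.
    · obtain ⟨n, ⟨r₀, hr₀, rfl⟩, hmax⟩ :
          ∃ n ∈ (fun r => jumpCount r w) '' Set.Iio t, ∀ m ∈ (fun r => jumpCount r w) '' Set.Iio t,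
            m ≤ n := by
        have hfin : ((fun r => jumpCount r w) '' Set.Iio t).Finite :=
          (Set.finite_Iic (jumpCount t w)).subset (by
            rintro _ ⟨r, hr, rfl⟩
            exact jumpCount_mono hw (le_of_lt hr))
        obtain ⟨n, hn, h⟩ := hfin.exists_maximal
          ⟨_, 0, pos_iff_ne_zero.2 ht, rfl⟩
        exact ⟨n, hn, fun m hm => (le_total m n).elim id (h hm)⟩
      refine ⟨path F r₀ x w, tendsto_nhds_of_eventually_eq ?_⟩
      filter_upwards [Ioo_mem_nhdsLT hr₀] with r hr
      have : jumpCount r w = jumpCount r₀ w :=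
        le_antisymm (hmax _ ⟨r, hr.2, rfl⟩) (jumpCount_mono hw hr.1.le)
      rw [path, path, this]

theorem path_zero (F : E → G → E) (x : E) {w : ℕ → G × ℝ≥0} (h : 0 < (w 0).2) :
    path F 0 x w = x := by
  have : InStage 0 0 w := ⟨by simp [jumpTime], by simpa [jumpTime] using h⟩
  rw [path, this.jumpCount_eq, chain]

/-- Maps that intertwine the innovations intertwine the paths. -/
theorem map_path {E' : Type*} {F : E → G → E} {F' : E' → G → E'} {f : E → E'}
    (h : ∀ x g, f (F x g) = F' (f x) g) (t : ℝ≥0) (x : E) (w : ℕ → G × ℝ≥0) :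
    f (path F t x w) = path F' t (f x) w := by
  have : ∀ n, f (chain F x w n) = chain F' (f x) w n := fun n => by
    induction n with
    | zero => rfl
    | succ n ih => rw [chain, chain, h, ih]
  exact this _

theorem jumpTime_glue (n : ℕ) (w w' : ℕ → G × ℝ≥0) :
    jumpTime (glue n w w') n = jumpTime w n :=
  jumpTime_congr fun i hi => by simp [glue, hi]

theorem freeze_glue (g : G) (c : ℝ≥0) (n : ℕ) (w w' : ℕ → G × ℝ≥0) :
    freeze g c n (glue n w w') = freeze g c n w := by
  funext i
  by_cases hi : i < n <;> simp [freeze, glue, hi]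

theorem glue_add {M : Type*} (n : ℕ) (w w' : ℕ → M) : (fun i => glue n w w' (n + i)) = w' := by
  funext i
  simp [glue]

/-- With the first `n` entries fixed, the stage at time `s` constrains only the next holding time,
which is the event to which lack of memory applies. -/
theorem inStage_glue {s : ℝ≥0} {n : ℕ} {w w' : ℕ → G × ℝ≥0} :
    InStage s n (glue n w w') ↔ jumpTime w n ≤ s ∧ s - jumpTime w n < (w' 0).2 := by
  have h0 : glue n w w' n = w' 0 := by simp [glue]
  rw [InStage, jumpTime_succ, jumpTime_glue, h0]
  exact and_congr_right fun h => (tsub_lt_iff_left h).symm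

end Pathwise

end UniformizedChain

/-! ### Exponential holding times -/

namespace UniformizedChain

variable {E G : Type*}

/-- The exponential distribution with rate `lam`, characterised by its tails. -/
def IsExponential (lam : ℝ) (τ : Measure ℝ≥0) : Prop :=
  ∀ a : ℝ≥0, τ (Set.Ioi a) = ENNReal.ofReal (Real.exp (-(lam * a)))

theorem exists_isExponential {lam : ℝ} (hlam : 0 < lam) :
    ∃ τ : Measure ℝ≥0, IsProbabilityMeasure τ ∧ IsExponential lam τ := by
  have := isProbabilityMeasure_expMeasure hlam
  refine ⟨(expMeasure lam).map Real.toNNReal,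
    Measure.isProbabilityMeasure_map measurable_real_toNNReal.aemeasurable, fun a => ?_⟩
  rw [Measure.map_apply measurable_real_toNNReal measurableSet_Ioi]
  have h1 : Real.toNNReal ⁻¹' Set.Ioi a = (Set.Iic (a : ℝ))ᶜ := by
    ext x
    simp [Real.lt_toNNReal_iff_coe_lt]
  have h2 := cdf_expMeasure_eq hlam (a : ℝ)
  rw [cdf_eq_real, if_pos a.coe_nonneg] at h2
  rw [h1, ← ofReal_measureReal (measure_ne_top _ _), probReal_compl_eq_one_sub measurableSet_Iic,
    h2]
  simp

theorem IsExponential.real_Ioi {lam : ℝ} {τ : Measure ℝ≥0} (h : IsExponential lam τ) (a : ℝ≥0) :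
    τ.real (Set.Ioi a) = Real.exp (-(lam * a)) := by
  rw [Measure.real, h a, ENNReal.toReal_ofReal (Real.exp_pos _).le]

theorem IsExponential.real_Iic {lam : ℝ} {τ : Measure ℝ≥0} [IsProbabilityMeasure τ]
    (h : IsExponential lam τ) (a : ℝ≥0) :
    τ.real (Set.Iic a) = 1 - Real.exp (-(lam * a)) := by
  rw [← h.real_Ioi, ← Set.compl_Iic, probReal_compl_eq_one_sub measurableSet_Iic]
  ring

/-- The memoryless property of the exponential distribution. -/
theorem IsExponential.map_sub {lam : ℝ} {τ : Measure ℝ≥0} [IsProbabilityMeasure τ]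
    (h : IsExponential lam τ) (a : ℝ≥0) :
    (τ.restrict (Set.Ioi a)).map (fun x => x - a) = τ (Set.Ioi a) • τ := by
  have hm : Measurable fun x : ℝ≥0 => x - a := by fun_prop
  have : IsFiniteMeasure ((τ.restrict (Set.Ioi a)).map (fun x => x - a)) :=
    Measure.isFiniteMeasure_map _ _
  refine Measure.ext_of_Iic _ _ fun b => ?_
  rw [Measure.map_apply hm measurableSet_Iic, Measure.restrict_apply (hm measurableSet_Iic),
    Measure.smul_apply, smul_eq_mul]
  have hset : (fun x : ℝ≥0 => x - a) ⁻¹' Set.Iic b ∩ Set.Ioi a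
      = Set.Iic (a + b) \ Set.Iic a := by
    ext x
    simp [and_comm, add_comm]
  rw [hset, ← ENNReal.toReal_eq_toReal_iff' (measure_ne_top _ _)
    (ENNReal.mul_ne_top (measure_ne_top _ _) (measure_ne_top _ _)), ENNReal.toReal_mul]
  change τ.real _ = τ.real _ * τ.real _
  rw [measureReal_sdiff (Set.Iic_subset_Iic.2 le_self_add) measurableSet_Iic, h.real_Iic,
    h.real_Iic, h.real_Ioi, h.real_Iic]
  have : Real.exp (-(lam * ((a + b : ℝ≥0) : ℝ)))
      = Real.exp (-(lam * a)) * Real.exp (-(lam * b)) := by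
    rw [← Real.exp_add]
    push_cast
    ring_nf
  rw [this]
  ring

/-! ### Measurability, and splicing of i.i.d. sequences -/

section Measurability

variable [MeasurableSpace E] [MeasurableSpace G]

theorem measurable_jumpTime (n : ℕ) :
    Measurable fun w : ℕ → G × ℝ≥0 => jumpTime w n := by
  unfold jumpTime
  fun_prop

theorem measurableSet_inStage (s : ℝ≥0) (n : ℕ) :
    MeasurableSet {w : ℕ → G × ℝ≥0 | InStage s n w} :=
  MeasurableSet.inter (s₁ := {w | jumpTime w n ≤ s}) (s₂ := {w | s < jumpTime w (n + 1)})
    (measurableSet_le (measurable_jumpTime n) measurable_const)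
    (measurableSet_lt measurable_const (measurable_jumpTime (n + 1)))

theorem measurableSet_nonExplosive :
    MeasurableSet {w : ℕ → G × ℝ≥0 | NonExplosive w} := by
  have : {w : ℕ → G × ℝ≥0 | NonExplosive w} = ⋂ m : ℕ, ⋃ n, {w | (m : ℝ≥0) < jumpTime w n} := by
    ext w
    simp only [Set.mem_ofPred_eq, Set.mem_iInter, Set.mem_iUnion]
    refine ⟨fun h m => h m, fun h t => ?_⟩
    obtain ⟨m, hm⟩ := exists_nat_gt t
    obtain ⟨n, hn⟩ := h m
    exact ⟨n, hm.trans hn⟩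
  rw [this]
  exact MeasurableSet.iInter fun m => MeasurableSet.iUnion fun n =>
    measurableSet_lt measurable_const (measurable_jumpTime n)

theorem measurable_jumpCount (t : ℝ≥0) :
    Measurable fun w : ℕ → G × ℝ≥0 => jumpCount t w := by
  refine measurable_to_countable' fun n => ?_
  -- The second set accounts for explosion: the infimum of the empty set is `0`, so these `w`
  -- contribute to the fibre over `0` only.
  have : (fun w : ℕ → G × ℝ≥0 => jumpCount t w) ⁻¹' {n}
      = {w | InStage t n w} ∪ (⋂ m, {w | jumpTime w m ≤ t}) ∩ {_w | n = 0} := by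
    ext w
    simp only [Set.mem_preimage, Set.mem_singleton_iff, Set.mem_union, Set.mem_ofPred_eq,
      Set.mem_inter_iff, Set.mem_iInter]
    constructor
    · rintro rfl
      by_cases h : ∃ m, t < jumpTime w m
      · exact Or.inl (inStage_jumpCount h.choose_spec)
      · push Not at h
        refine Or.inr ⟨h, ?_⟩
        have : {n | t < jumpTime w (n + 1)} = ∅ := by
          ext n
          simp [h]
        rw [jumpCount, this, Nat.sInf_empty]
    · rintro (h | ⟨h, rfl⟩)
      · exact h.jumpCount_eq
      · have : {n | t < jumpTime w (n + 1)} = ∅ := by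
          ext n
          simp [h]
        rw [jumpCount, this, Nat.sInf_empty]
  rw [this]
  exact (measurableSet_inStage t n).union ((MeasurableSet.iInter fun m =>
    measurableSet_le (measurable_jumpTime m) measurable_const).inter (MeasurableSet.const _))

theorem measurable_chain {F : E → G → E} (hF : Measurable (Function.uncurry F)) (n : ℕ) :
    Measurable fun p : E × (ℕ → G × ℝ≥0) => chain F p.1 p.2 n := by
  induction n with
  | zero => exact measurable_fst
  | succ n ih =>
    have : Measurable fun p : E × (ℕ → G × ℝ≥0) => (p.2 n).1 := by fun_prop
    exact hF.comp (ih.prodMk this)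

theorem measurable_path {F : E → G → E} (hF : Measurable (Function.uncurry F)) (t : ℝ≥0) :
    Measurable fun p : E × (ℕ → G × ℝ≥0) => path F t p.1 p.2 := by
  have h : Measurable fun q : ℕ × (E × (ℕ → G × ℝ≥0)) => chain F q.2.1 q.2.2 q.1 :=
    measurable_from_prod_countable_right fun n => measurable_chain hF n
  exact h.comp (((measurable_jumpCount t).comp measurable_snd).prodMk measurable_id)

theorem measurable_path_right {F : E → G → E} (hF : Measurable (Function.uncurry F)) (t : ℝ≥0)
    (x : E) : Measurable (path F t x) :=
  (measurable_path hF t).comp measurable_prodMk_left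

theorem measurable_age : Measurable fun p : ℝ≥0 × (ℕ → G × ℝ≥0) => age p.1 p.2 := by
  refine measurable_pi_lambda _ fun i => ?_
  by_cases hi : i = 0
  · simp only [age, hi, if_true]
    fun_prop
  · simp only [age, hi, if_false]
    fun_prop

theorem measurable_freeze (g : G) (c : ℝ≥0) (n : ℕ) :
    Measurable fun w : ℕ → G × ℝ≥0 => freeze g c n w := by
  refine measurable_pi_lambda _ fun i => ?_
  by_cases hi : i < n
  · simp only [freeze, hi, if_true]
    fun_prop
  · simp only [freeze, hi, if_false]
    fun_prop

theorem measurable_glue {M : Type*} [MeasurableSpace M] (n : ℕ) :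
    Measurable fun p : (ℕ → M) × (ℕ → M) => glue n p.1 p.2 := by
  refine measurable_pi_lambda _ fun i => ?_
  by_cases hi : i < n
  · simp only [glue, hi, if_true]
    fun_prop
  · simp only [glue, hi, if_false]
    fun_prop

/-- An i.i.d. sequence stays i.i.d. when it is continued by an independent copy. -/
theorem map_glue {M : Type*} [MeasurableSpace M] (μ : Measure M) [IsProbabilityMeasure μ] (n : ℕ) :
    ((Measure.infinitePi fun _ : ℕ => μ).prod (Measure.infinitePi fun _ : ℕ => μ)).map
      (fun p => glue n p.1 p.2) = Measure.infinitePi fun _ : ℕ => μ := by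
  refine Measure.eq_infinitePi _ fun s t ht => ?_
  rw [Measure.map_apply (measurable_glue n)
    (MeasurableSet.pi s.countable_toSet fun i _ => ht i)]
  have hset : (fun p : (ℕ → M) × (ℕ → M) => glue n p.1 p.2) ⁻¹' Set.pi s t
      = Set.pi (s.filter (· < n)) t ×ˢ
        Set.pi ((s.filter (¬ · < n)).image (· - n)) (fun i => t (i + n)) := by
    ext p
    simp only [Set.mem_preimage, Set.mem_pi, Set.mem_prod, Finset.mem_coe, Finset.mem_filter,
      Finset.mem_image, glue]
    constructor
    · refine fun h => ⟨fun i hi => by simpa [hi.2] using h i hi.1, ?_⟩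
      rintro _ ⟨i, hi, rfl⟩
      have := h i hi.1
      rw [if_neg hi.2] at this
      rwa [Nat.sub_add_cancel (not_lt.1 hi.2)]
    · rintro ⟨h1, h2⟩ i hi
      by_cases hin : i < n
      · rw [if_pos hin]
        exact h1 i ⟨hi, hin⟩
      · rw [if_neg hin]
        have := h2 (i - n) ⟨i, ⟨hi, hin⟩, rfl⟩
        rwa [Nat.sub_add_cancel (not_lt.1 hin)] at this
  rw [hset, Measure.prod_prod, Measure.infinitePi_pi _ fun i _ => ht i,
    Measure.infinitePi_pi _ fun i _ => ht _, Finset.prod_image,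
    ← Finset.prod_filter_mul_prod_filter_not s (· < n)]
  · congr 1
    refine Finset.prod_congr rfl fun i hi => ?_
    rw [Nat.sub_add_cancel (not_lt.1 (Finset.mem_filter.1 hi).2)]
  · intro i hi j hj hij
    have h1 := (Finset.mem_filter.1 hi).2
    have h2 := (Finset.mem_filter.1 hj).2
    simp only at hij
    omega

end Measurability

/-! ### The law of the driving sequence and its lack of memory -/

section Law

variable [MeasurableSpace E] [MeasurableSpace G]

/-- The law of i.i.d. innovations with law `ρ` and independent i.i.d. holding times with
law `τ`. -/
noncomputable def drivingLaw (ρ : Measure G) (τ : Measure ℝ≥0) : Measure (ℕ → G × ℝ≥0) :=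
  Measure.infinitePi fun _ => ρ.prod τ

variable (ρ : Measure G) [IsProbabilityMeasure ρ] {τ : Measure ℝ≥0} [IsProbabilityMeasure τ]
  {lam : ℝ}

instance (τ : Measure ℝ≥0) [IsProbabilityMeasure τ] : IsProbabilityMeasure (drivingLaw ρ τ) := by
  unfold drivingLaw
  infer_instance

theorem drivingLaw_preimage_zero (τ : Measure ℝ≥0) [IsProbabilityMeasure τ] {S : Set (G × ℝ≥0)}
    (hS : MeasurableSet S) : drivingLaw ρ τ {w | w 0 ∈ S} = ρ.prod τ S := by
  have := measurePreserving_eval_infinitePi (fun _ : ℕ => ρ.prod τ) 0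
  exact this.measure_preimage hS.nullMeasurableSet

theorem drivingLaw_lt_zero (hτ : IsExponential lam τ) (a : ℝ≥0) :
    drivingLaw ρ τ {w | a < (w 0).2} = ENNReal.ofReal (Real.exp (-(lam * a))) := by
  have h : {w : ℕ → G × ℝ≥0 | a < (w 0).2} = {w | w 0 ∈ Set.univ ×ˢ Set.Ioi a} := by
    ext w
    simp
  rw [h, drivingLaw_preimage_zero ρ τ (MeasurableSet.univ.prod measurableSet_Ioi),
    Measure.prod_prod, measure_univ, one_mul, hτ a]

theorem ae_pos_zero (hτ : IsExponential lam τ) : ∀ᵐ w ∂drivingLaw ρ τ, 0 < (w 0).2 := by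
  have hm : MeasurableSet {w : ℕ → G × ℝ≥0 | 0 < (w 0).2} :=
    measurableSet_lt measurable_const (by fun_prop)
  refine (mem_ae_iff_prob_eq_one hm).2 ?_
  simpa using drivingLaw_lt_zero ρ hτ 0

/-- Given that the first holding time exceeds `a`, the driving sequence aged by `a` has the same
law as the original one. -/
theorem drivingLaw_age (hτ : IsExponential lam τ) (a : ℝ≥0) {D : Set (ℕ → G × ℝ≥0)}
    (hD : MeasurableSet D) :
    drivingLaw ρ τ {w | a < (w 0).2 ∧ age a w ∈ D}
      = ENNReal.ofReal (Real.exp (-(lam * a))) * drivingLaw ρ τ D := by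
  set c := ENNReal.ofReal (Real.exp (-(lam * a))) with hc
  have hc0 : c ≠ 0 := by simp [hc, Real.exp_pos]
  have hct : c ≠ ∞ := ENNReal.ofReal_ne_top
  have hage : Measurable (age a : (ℕ → G × ℝ≥0) → _) := measurable_age.comp measurable_prodMk_left
  have hone : ∀ S : Set (G × ℝ≥0), MeasurableSet S →
      ρ.prod τ {p | a < p.2 ∧ (p.1, p.2 - a) ∈ S} = c * ρ.prod τ S := fun S hS => by
    have hmap : ((ρ.prod τ).restrict (Set.univ ×ˢ Set.Ioi a)).map (Prod.map id fun x => x - a)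
        = c • ρ.prod τ := by
      rw [← Measure.prod_restrict, Measure.restrict_univ, ← Measure.map_prod_map _ _ measurable_id
        (by fun_prop), Measure.map_id, hτ.map_sub, hτ a, Measure.prod_smul_right]
    have := congrArg (fun μ => μ S) hmap
    simp only [Measure.smul_apply, smul_eq_mul] at this
    rw [← this, Measure.map_apply (by fun_prop) hS, Measure.restrict_apply
      (hS.preimage (by fun_prop))]
    congr 1
    ext p
    simp [and_comm, Prod.map]
  -- The conditional law of the aged sequence is identified with the product measure by its values
  -- on finite boxes.
  have hlaw : c⁻¹ • ((drivingLaw ρ τ).restrict {w | a < (w 0).2}).map (age a)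
      = drivingLaw ρ τ := by
    refine Measure.eq_infinitePi _ fun s t ht => ?_
    have hst : MeasurableSet (Set.pi (s : Set ℕ) t) :=
      MeasurableSet.pi s.countable_toSet fun i _ => ht i
    rw [Measure.smul_apply, Measure.map_apply hage hst, Measure.restrict_apply (hage hst)]
    -- The conditioning always involves coordinate `0`, so this coordinate is added to the box, with
    -- no constraint of its own when `0 ∉ s`.
    set t₀ : Set (G × ℝ≥0) := if 0 ∈ s then t 0 else Set.univ with ht₀
    have ht₀m : MeasurableSet t₀ := by
      rw [ht₀]
      split_ifs
      exacts [ht 0, .univ]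
    let u : ℕ → Set (G × ℝ≥0) := fun i => if i = 0 then {p | a < p.2 ∧ (p.1, p.2 - a) ∈ t₀} else t i
    have hu : ∀ i, MeasurableSet (u i) := fun i => by
      by_cases hi : i = 0
      · simp only [u, hi, if_true]
        exact (measurableSet_lt measurable_const measurable_snd).inter
          (ht₀m.preimage (f := fun p : G × ℝ≥0 => (p.1, p.2 - a)) (by fun_prop))
      · simp only [u, hi, if_false]
        exact ht i
    have hset : age a ⁻¹' Set.pi s t ∩ {w | a < (w 0).2}
        = Set.pi ((insert 0 s : Finset ℕ) : Set ℕ) u := by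
      ext w
      simp only [Set.mem_inter_iff, Set.mem_preimage, Set.mem_pi, Finset.mem_coe, Set.mem_ofPred_eq,
        Finset.mem_insert, forall_eq_or_imp, u, if_true, ht₀, age]
      constructor
      · rintro ⟨h1, h2⟩
        refine ⟨⟨h2, ?_⟩, fun i hi => ?_⟩
        · split_ifs with h0
          · simpa using h1 0 h0
          · trivial
        · by_cases hi0 : i = 0
          · subst hi0
            have := h1 0 hi
            simp only [if_true] at this ⊢
            rw [if_pos hi]
            exact ⟨h2, this⟩
          · simpa [hi0] using h1 i hi
      · rintro ⟨⟨h1, h2⟩, h3⟩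
        refine ⟨fun i hi => ?_, h1⟩
        by_cases hi0 : i = 0
        · subst hi0
          simpa [hi] using h2
        · simpa [hi0] using h3 i hi
    rw [hset, drivingLaw, Measure.infinitePi_pi _ fun i _ => hu i,
      ← Finset.mul_prod_erase _ _ (Finset.mem_insert_self 0 s)]
    have h0 : ρ.prod τ (u 0) = c * ρ.prod τ t₀ := by
      simp only [u, if_true]
      exact hone t₀ ht₀m
    have hrest : ∏ i ∈ (insert 0 s).erase 0, ρ.prod τ (u i)
        = ∏ i ∈ s.erase 0, ρ.prod τ (t i) := by
      have : (insert 0 s).erase 0 = s.erase 0 := by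
        ext i
        simp only [Finset.mem_erase, Finset.mem_insert]
        tauto
      rw [this]
      refine Finset.prod_congr rfl fun i hi => ?_
      simp only [u, (Finset.mem_erase.1 hi).1, if_false]
    rw [h0, hrest, smul_eq_mul, mul_assoc, ← mul_assoc, ENNReal.inv_mul_cancel hc0 hct, one_mul]
    by_cases hs : 0 ∈ s
    · rw [ht₀, if_pos hs, Finset.mul_prod_erase _ (fun i => ρ.prod τ (t i)) hs]
    · rw [ht₀, if_neg hs, measure_univ, one_mul, Finset.erase_eq_of_notMem hs]
  have h1 : {w | a < (w 0).2 ∧ age a w ∈ D} = age a ⁻¹' D ∩ {w | a < (w 0).2} := by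
    ext w
    simp [and_comm]
  rw [h1, ← Measure.restrict_apply (hage hD), ← Measure.map_apply hage hD]
  conv_rhs => rw [← hlaw]
  rw [Measure.smul_apply, smul_eq_mul, ← mul_assoc, ENNReal.mul_inv_cancel hc0 hct, one_mul]

end Law

end UniformizedChain

/-! ### Non-explosion, restart at a fixed time, and the semigroup -/

namespace UniformizedChain

variable {E G : Type*} [MeasurableSpace E] [MeasurableSpace G]
  (ρ : Measure G) [IsProbabilityMeasure ρ] {τ : Measure ℝ≥0} [IsProbabilityMeasure τ] {lam : ℝ}

/-- By the second Borel–Cantelli lemma infinitely many of the independent holding times exceed `1`,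
and each of these pushes the jump times up by at least `1`. -/
theorem ae_nonExplosive (hτ : IsExponential lam τ) :
    ∀ᵐ w ∂drivingLaw ρ τ, NonExplosive w := by
  let S : ℕ → Set (ℕ → G × ℝ≥0) := fun n => {w | 1 < (w n).2}
  have hS : ∀ n, MeasurableSet (S n) := fun n => measurableSet_lt measurable_const (by fun_prop)
  have hT : MeasurableSet {p : G × ℝ≥0 | 1 < p.2} := measurableSet_lt measurable_const (by fun_prop)
  have hind : iIndepSet S (drivingLaw ρ τ) := by
    rw [iIndepSet_iff_meas_biInter hS]
    intro s
    have h1 : (⋂ i ∈ s, S i) = Set.pi (s : Set ℕ) fun _ => {p : G × ℝ≥0 | 1 < p.2} := by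
      ext w
      simp [S]
    rw [h1, drivingLaw, Measure.infinitePi_pi _ fun _ _ => hT]
    refine Finset.prod_congr rfl fun i _ => ?_
    exact ((measurePreserving_eval_infinitePi (fun _ : ℕ => ρ.prod τ) i).measure_preimage
      hT.nullMeasurableSet).symm
  have hmeas : ∀ n, drivingLaw ρ τ (S n) = ENNReal.ofReal (Real.exp (-(lam * (1 : ℝ≥0)))) := by
    intro n
    rw [← drivingLaw_lt_zero ρ hτ]
    exact ((measurePreserving_eval_infinitePi (fun _ : ℕ => ρ.prod τ) n).measure_preimage
      hT.nullMeasurableSet).trans ((measurePreserving_eval_infinitePi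
        (fun _ : ℕ => ρ.prod τ) 0).measure_preimage hT.nullMeasurableSet).symm
  have hlim := measure_limsup_eq_one hS hind (by
    simp only [hmeas]
    exact ENNReal.tsum_const_eq_top_of_ne_zero (by simp [Real.exp_pos]))
  have hae : ∀ᵐ w ∂drivingLaw ρ τ, w ∈ limsup S atTop :=
    (mem_ae_iff_prob_eq_one (MeasurableSet.measurableSet_limsup hS)).2 hlim
  filter_upwards [hae] with w hw
  rw [mem_limsup_iff_frequently_mem] at hw
  have hgrow : ∀ m : ℕ, ∃ n, (m : ℝ≥0) ≤ jumpTime w n := by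
    intro m
    induction m with
    | zero => exact ⟨0, by simp⟩
    | succ m ih =>
      obtain ⟨n, hn⟩ := ih
      obtain ⟨i, hi, hiS⟩ := frequently_atTop.1 hw n
      refine ⟨i + 1, ?_⟩
      rw [jumpTime_succ]
      push_cast
      exact add_le_add (hn.trans (jumpTime_mono w hi)) (le_of_lt hiS)
  intro t
  obtain ⟨m, hm⟩ := exists_nat_gt t
  obtain ⟨n, hn⟩ := hgrow m
  exact ⟨n, hm.trans_le hn⟩

theorem measurableSet_lt_zero (a : ℝ≥0) : MeasurableSet {w : ℕ → G × ℝ≥0 | a < (w 0).2} :=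
  measurableSet_lt measurable_const (by fun_prop)

/-- Given the first `n` innovations and holding times, and given that exactly `n` jumps occur up to
time `s`, the driving sequence after time `s` has the original law. -/
theorem drivingLaw_restart (hτ : IsExponential lam τ) (g : G) (c s : ℝ≥0) (n : ℕ)
    {Q : Set ((ℕ → G × ℝ≥0) × (ℕ → G × ℝ≥0))} (hQ : MeasurableSet Q) :
    drivingLaw ρ τ {w | InStage s n w ∧
        (freeze g c n w, age (s - jumpTime w n) fun i => w (n + i)) ∈ Q}
      = ∫⁻ w in {w | InStage s n w}, drivingLaw ρ τ {w' | (freeze g c n w, w') ∈ Q}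
          ∂drivingLaw ρ τ := by
  set W := drivingLaw ρ τ with hW
  -- Entries from index `n` on are replaced by an independent copy. Fubini then allows the first `n`
  -- entries to be fixed while `drivingLaw_age` is applied to the copy.
  have hglue : (W.prod W).map (fun p => glue n p.1 p.2) = W := map_glue _ n
  have hmeas : Measurable fun w : ℕ → G × ℝ≥0 =>
      (freeze g c n w, age (s - jumpTime w n) fun i => w (n + i)) := by
    refine (measurable_freeze g c n).prodMk ?_
    exact measurable_age.comp ((measurable_const.sub (measurable_jumpTime n)).prodMk
      (measurable_pi_lambda _ fun i => measurable_pi_apply _))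
  have hA : MeasurableSet {w : ℕ → G × ℝ≥0 | InStage s n w ∧
      (freeze g c n w, age (s - jumpTime w n) fun i => w (n + i)) ∈ Q} :=
    MeasurableSet.inter (measurableSet_inStage s n) (hmeas hQ)
  have hφ : Measurable fun w : ℕ → G × ℝ≥0 => W {w' | (freeze g c n w, w') ∈ Q} :=
    (measurable_measure_prodMk_left hQ).comp (measurable_freeze g c n)
  have hind : Measurable ({w : ℕ → G × ℝ≥0 | InStage s n w}.indicator
      fun w => W {w' | (freeze g c n w, w') ∈ Q}) := hφ.indicator (measurableSet_inStage s n)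
  rw [← lintegral_indicator (measurableSet_inStage s n)]
  have hR := congrArg (fun μ => ∫⁻ w, {w : ℕ → G × ℝ≥0 | InStage s n w}.indicator
    (fun w => W {w' | (freeze g c n w, w') ∈ Q}) w ∂μ) hglue
  rw [← hR]
  conv_lhs => rw [← hglue]
  rw [Measure.map_apply (measurable_glue n) hA, Measure.prod_apply (measurable_glue n hA),
    lintegral_map hind (measurable_glue n),
    lintegral_prod (fun p : (ℕ → G × ℝ≥0) × (ℕ → G × ℝ≥0) =>
      {w | InStage s n w}.indicator (fun w => W {w' | (freeze g c n w, w') ∈ Q}) (glue n p.1 p.2))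
      (hind.comp (measurable_glue n)).aemeasurable]
  refine lintegral_congr fun w => ?_
  by_cases hw : jumpTime w n ≤ s
  · set a := s - jumpTime w n with ha
    have h1 : Prod.mk w ⁻¹' ((fun p : (ℕ → G × ℝ≥0) × (ℕ → G × ℝ≥0) => glue n p.1 p.2) ⁻¹'
        {w | InStage s n w ∧ (freeze g c n w, age (s - jumpTime w n) fun i => w (n + i)) ∈ Q})
        = {w' | a < (w' 0).2 ∧ age a w' ∈ {v | (freeze g c n w, v) ∈ Q}} := by
      ext w'
      simp only [Set.mem_preimage, Set.mem_ofPred_eq, inStage_glue, freeze_glue, jumpTime_glue,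
        glue_add, hw, true_and, ha]
    have h2 : (fun w' => {w : ℕ → G × ℝ≥0 | InStage s n w}.indicator
        (fun w => W {w' | (freeze g c n w, w') ∈ Q}) (glue n w w'))
        = {w' : ℕ → G × ℝ≥0 | a < (w' 0).2}.indicator
          fun _ => W {w' | (freeze g c n w, w') ∈ Q} := by
      funext w'
      simp only [Set.indicator, Set.mem_ofPred_eq, inStage_glue, freeze_glue, hw, true_and, ha]
    rw [h1, h2, lintegral_indicator_const (measurableSet_lt_zero a),
      drivingLaw_age ρ hτ a (D := {v | (freeze g c n w, v) ∈ Q}) (measurable_prodMk_left hQ),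
      drivingLaw_lt_zero ρ hτ, mul_comm]
  · have h1 : Prod.mk w ⁻¹' ((fun p : (ℕ → G × ℝ≥0) × (ℕ → G × ℝ≥0) => glue n p.1 p.2) ⁻¹'
        {w | InStage s n w ∧ (freeze g c n w, age (s - jumpTime w n) fun i => w (n + i)) ∈ Q})
        = ∅ := by
      ext w'
      simp [inStage_glue, hw]
    have h2 : (fun w' => {w : ℕ → G × ℝ≥0 | InStage s n w}.indicator
        (fun w => W {w' | (freeze g c n w, w') ∈ Q}) (glue n w w')) = fun _ => 0 := by
      funext w'
      simp [inStage_glue, hw]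
    rw [h1, h2]
    simp

/-- The transition semigroup of the continuous-time chain. -/
noncomputable def transition (F : E → G → E) (ρ : Measure G) (τ : Measure ℝ≥0) (t : ℝ≥0) :
    Kernel E E :=
  (Kernel.id ×ₖ Kernel.const E (drivingLaw ρ τ)).map fun p => path F t p.1 p.2

variable {F : E → G → E}

theorem transition_apply (hF : Measurable (Function.uncurry F)) (t : ℝ≥0) (x : E) {A : Set E}
    (hA : MeasurableSet A) :
    transition F ρ τ t x A = drivingLaw ρ τ {w | path F t x w ∈ A} := by
  rw [transition, Kernel.map_apply' _ (measurable_path hF t) _ hA, Kernel.prod_apply,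
    Kernel.id_apply, Kernel.const_apply, Measure.dirac_prod,
    Measure.map_apply measurable_prodMk_left (measurable_path hF t hA)]
  rfl

/-- The Markov property at time `s` for the events that only depend on the path up to `s`. -/
theorem drivingLaw_markov (hF : Measurable (Function.uncurry F)) (hτ : IsExponential lam τ)
    (g : G) (x : E) (s t : ℝ≥0) {C : Set (ℕ → G × ℝ≥0)} (hC : MeasurableSet C)
    (hfreeze : ∀ n w, InStage s n w → (freeze g (s + 1) n w ∈ C ↔ w ∈ C))
    {A : Set E} (hA : MeasurableSet A) :
    drivingLaw ρ τ (C ∩ {w | path F (s + t) x w ∈ A})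
      = ∫⁻ w in C, transition F ρ τ t (path F s x w) A ∂drivingLaw ρ τ := by
  set W := drivingLaw ρ τ with hW
  have hstage := fun n => measurableSet_inStage (G := G) s n
  -- Almost surely exactly one stage holds at time `s`, so both sides split into sums over the
  -- number `n` of jumps, to which the restart applies term by term.
  have hcover : (⋃ n, C ∩ {w : ℕ → G × ℝ≥0 | InStage s n w}) =ᵐ[W] C := by
    rw [← Set.inter_iUnion]
    filter_upwards [ae_nonExplosive ρ hτ] with w hw
    refine propext ⟨fun h => h.1, fun h => ⟨h, Set.mem_iUnion.2 ⟨_, hw.inStage s⟩⟩⟩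
  have hdisj : Pairwise (Function.onFun Disjoint
      fun n => C ∩ {w : ℕ → G × ℝ≥0 | InStage s n w}) := fun m n hmn =>
    Set.disjoint_left.2 fun w hm hn => hmn (InStage.unique hm.2 hn.2)
  have hmA : MeasurableSet {w | path F (s + t) x w ∈ A} := measurable_path_right hF _ x hA
  rw [Set.inter_comm, ← Measure.restrict_apply hmA, ← Measure.restrict_congr_set hcover,
    Measure.restrict_iUnion_apply hdisj (fun n => hC.inter (hstage n)) hmA,
    lintegral_iUnion (fun n => hC.inter (hstage n)) hdisj]
  refine tsum_congr fun n => ?_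
  let Q : Set ((ℕ → G × ℝ≥0) × (ℕ → G × ℝ≥0)) :=
    {p | p.1 ∈ C ∧ path F t (path F s x p.1) p.2 ∈ A}
  have hQ : MeasurableSet Q := by
    refine MeasurableSet.inter (measurable_fst hC) ?_
    exact (measurable_path hF t).comp
      (((measurable_path_right hF s x).comp measurable_fst).prodMk measurable_snd) hA
  have key := drivingLaw_restart ρ hτ g (s + 1) s n hQ
  rw [← hW] at key
  rw [Measure.restrict_apply hmA]
  calc W ({w | path F (s + t) x w ∈ A} ∩ (C ∩ {w | InStage s n w}))
      = W {w | InStage s n w ∧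
        (freeze g (s + 1) n w, age (s - jumpTime w n) fun i => w (n + i)) ∈ Q} := by
        refine measure_congr ?_
        filter_upwards [ae_nonExplosive ρ hτ] with w hw
        refine propext ?_
        change (path F (s + t) x w ∈ A ∧ w ∈ C ∧ InStage s n w) ↔ (InStage s n w ∧
          freeze g (s + 1) n w ∈ C ∧ path F t (path F s x (freeze g (s + 1) n w)) _ ∈ A)
        by_cases h : InStage s n w
        · rw [hfreeze n w h, path_freeze F x le_rfl h, path_add F x t hw h]
          tauto
        · tauto
    _ = ∫⁻ w in {w | InStage s n w}, C.indicator
        (fun w => transition F ρ τ t (path F s x w) A) w ∂W := by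
        rw [key]
        refine setLIntegral_congr_fun (hstage n) fun w hw => ?_
        have hw' : InStage s n w := hw
        by_cases hwC : w ∈ C
        · rw [Set.indicator_of_mem hwC, transition_apply ρ hF t _ hA]
          simp only [Q, Set.mem_ofPred_eq, hfreeze n w hw', hwC, true_and,
            path_freeze F x le_rfl hw']
          rfl
        · simp [Q, hfreeze n w hw', hwC]
    _ = _ := by
        rw [lintegral_indicator hC, Measure.restrict_restrict hC]

/-- Chapman–Kolmogorov is the Markov property at time `s` with the trivial past event. At time `0`
the path is at its starting point because the first holding time is almost surely positive. -/
theorem isMarkovSemigroup_transition (hF : Measurable (Function.uncurry F))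
    (hτ : IsExponential lam τ) :
    IsMarkovSemigroup (transition F ρ τ) where
  isMarkovKernel t := Kernel.IsMarkovKernel.map _ (measurable_path hF t)
  zero := by
    ext x A hA
    rw [transition_apply ρ hF 0 x hA, Kernel.id_apply, Measure.dirac_apply' _ hA]
    have : drivingLaw ρ τ {w | path F 0 x w ∈ A} = drivingLaw ρ τ {_w | x ∈ A} := by
      refine measure_congr ?_
      filter_upwards [ae_pos_zero ρ hτ] with w hw
      change (path F 0 x w ∈ A) = (x ∈ A)
      rw [path_zero F x hw]
    rw [this]
    by_cases hx : x ∈ A <;> simp [hx]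
  add s t := by
    ext x A hA
    obtain ⟨g⟩ : Nonempty G := nonempty_of_isProbabilityMeasure ρ
    have h1 := drivingLaw_markov ρ hF hτ g x s t MeasurableSet.univ (by simp) hA
    rw [Set.univ_inter, Measure.restrict_univ] at h1
    have hPs : transition F ρ τ s x = (drivingLaw ρ τ).map (path F s x) := by
      ext B hB
      rw [transition_apply ρ hF s x hB, Measure.map_apply (measurable_path_right hF s x) hB]
      rfl
    rw [transition_apply ρ hF _ x hA, h1, Kernel.comp_apply' _ _ _ hA, hPs,
      lintegral_map (Kernel.measurable_coe _ hA) (measurable_path_right hF s x)]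

end UniformizedChain

/-! ### The Markov property with respect to the history, and the jump rates -/

namespace UniformizedChain

/-- Past events become preimages of sets of paths on `[0, s]`; such events are unchanged by
`freeze`, as `drivingLaw_markov` requires. -/
theorem history_eq_comap {Ω E : Type*} [MeasurableSpace E] (X : ℝ≥0 → Ω → E) (s : ℝ≥0) :
    history X s = MeasurableSpace.comap (fun ω (r : {r : ℝ≥0 // r ≤ s}) => X r ω)
      MeasurableSpace.pi := by
  simp only [history, MeasurableSpace.pi, MeasurableSpace.comap_iSup, MeasurableSpace.comap_comp]
  rfl

variable {E G : Type*} [MeasurableSpace E] [MeasurableSpace G]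
  (ρ : Measure G) [IsProbabilityMeasure ρ] {τ : Measure ℝ≥0} [IsProbabilityMeasure τ] {lam : ℝ}
  {F : E → G → E}

/-- The Markov property of the continuous-time chain, tested on events from the past. -/
theorem measure_inter_path (hF : Measurable (Function.uncurry F)) (hτ : IsExponential lam τ)
    {Ω E₀ : Type*} [MeasurableSpace Ω] [MeasurableSpace E₀] {μ : Measure Ω} {μ₀ : Measure E₀}
    [IsProbabilityMeasure μ₀] {ψ : Ω → E₀ × (ℕ → G × ℝ≥0)}
    (hψ : MeasurePreserving ψ μ (μ₀.prod (drivingLaw ρ τ))) {f : E₀ → E} (hf : Measurable f)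
    (s t : ℝ≥0) {H : Set Ω}
    (hH : MeasurableSet[history (fun t ω => path F t (f (ψ ω).1) (ψ ω).2) s] H)
    {A : Set E} (hA : MeasurableSet A) :
    μ (H ∩ {ω | path F (s + t) (f (ψ ω).1) (ψ ω).2 ∈ A})
      = ∫⁻ ω in H, transition F ρ τ t (path F s (f (ψ ω).1) (ψ ω).2) A ∂μ := by
  obtain ⟨g⟩ : Nonempty G := nonempty_of_isProbabilityMeasure ρ
  rw [history_eq_comap] at hH
  obtain ⟨V, hV, rfl⟩ := hH
  set W := drivingLaw ρ τ with hW
  have hX : ∀ r, Measurable fun p : E₀ × (ℕ → G × ℝ≥0) => path F r (f p.1) p.2 := fun r =>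
    (measurable_path hF r).comp ((hf.comp measurable_fst).prodMk measurable_snd)
  let H' : Set (E₀ × (ℕ → G × ℝ≥0)) :=
    (fun p (r : {r : ℝ≥0 // r ≤ s}) => path F r (f p.1) p.2) ⁻¹' V
  have hpast : Measurable fun (p : E₀ × (ℕ → G × ℝ≥0)) (r : {r : ℝ≥0 // r ≤ s}) =>
      path F r (f p.1) p.2 := measurable_pi_lambda _ fun r => hX r
  have hH' : MeasurableSet H' := hpast hV
  have hA' : MeasurableSet {p : E₀ × (ℕ → G × ℝ≥0) | path F (s + t) (f p.1) p.2 ∈ A} := hX _ hA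
  have hint : Measurable fun p : E₀ × (ℕ → G × ℝ≥0) =>
      transition F ρ τ t (path F s (f p.1) p.2) A := (Kernel.measurable_coe _ hA).comp (hX s)
  -- The initial state is independent of the driving sequence, so Fubini reduces to a deterministic
  -- starting point.
  calc μ (ψ ⁻¹' (H' ∩ {p | path F (s + t) (f p.1) p.2 ∈ A}))
      = (μ₀.prod W) (H' ∩ {p | path F (s + t) (f p.1) p.2 ∈ A}) :=
        hψ.measure_preimage (hH'.inter hA').nullMeasurableSet
    _ = ∫⁻ z, W (Prod.mk z ⁻¹' H' ∩ {w | path F (s + t) (f z) w ∈ A}) ∂μ₀ := by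
        rw [Measure.prod_apply (hH'.inter hA')]
        rfl
    _ = ∫⁻ z, ∫⁻ w in Prod.mk z ⁻¹' H', transition F ρ τ t (path F s (f z) w) A ∂W ∂μ₀ := by
        refine lintegral_congr fun z => ?_
        refine drivingLaw_markov ρ hF hτ g (f z) s t (measurable_prodMk_left hH') ?_ hA
        intro n w h
        have : (fun (r : {r : ℝ≥0 // r ≤ s}) => path F r (f z) (freeze g (s + 1) n w))
            = fun (r : {r : ℝ≥0 // r ≤ s}) => path F r (f z) w :=
          funext fun r => path_freeze F (f z) r.2 h g
        exact iff_of_eq (congrArg (· ∈ V) this)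
    _ = ∫⁻ p in H', transition F ρ τ t (path F s (f p.1) p.2) A ∂μ₀.prod W := by
        rw [← lintegral_indicator hH', lintegral_prod _ (hint.indicator hH').aemeasurable]
        refine lintegral_congr fun z => ?_
        rw [← lintegral_indicator (measurable_prodMk_left hH')]
        rfl
    _ = _ := by
        rw [← hψ.map_eq, setLIntegral_map hH' hint hψ.measurable]
        rfl

/-- The map `f` of the initial state lets one probability space serve both for the full process (`f`
the identity) and for its restrictions (`f` a restriction map), each with its own history. The
conditional expectation is recognised by its integrals over past events. -/
theorem isMarkovProcess_path (hF : Measurable (Function.uncurry F)) (hτ : IsExponential lam τ)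
    {Ω E₀ : Type*} [MeasurableSpace Ω] [MeasurableSpace E₀] {μ : Measure Ω}
    [IsProbabilityMeasure μ] {μ₀ : Measure E₀}
    [IsProbabilityMeasure μ₀] {ψ : Ω → E₀ × (ℕ → G × ℝ≥0)}
    (hψ : MeasurePreserving ψ μ (μ₀.prod (drivingLaw ρ τ))) {f : E₀ → E} (hf : Measurable f) :
    IsMarkovProcess (transition F ρ τ) (fun t ω => path F t (f (ψ ω).1) (ψ ω).2) μ := by
  set X : ℝ≥0 → Ω → E := fun t ω => path F t (f (ψ ω).1) (ψ ω).2 with hXdef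
  have hX : ∀ t, Measurable (X t) := fun t => (measurable_path hF t).comp
    ((hf.comp (measurable_fst.comp hψ.measurable)).prodMk (measurable_snd.comp hψ.measurable))
  refine ⟨hX, fun s t A hA => ?_⟩
  have hmarkov := (isMarkovSemigroup_transition ρ hF hτ).isMarkovKernel t
  have hle : history X s ≤ ‹MeasurableSpace Ω› :=
    iSup_le fun r => measurable_iff_comap_le.1 (hX r)
  have hXs : Measurable[history X s] (X s) :=
    Measurable.of_comap_le (le_iSup (fun r : {r : ℝ≥0 // r ≤ s} =>
      MeasurableSpace.comap (X r) inferInstance) ⟨s, le_rfl⟩)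
  have hP : Measurable fun x => transition F ρ τ t x A := Kernel.measurable_coe _ hA
  have hg : Measurable[history X s] fun ω => (transition F ρ τ t (X s ω)).real A :=
    hP.ennreal_toReal.comp hXs
  have hXA : MeasurableSet (X (s + t) ⁻¹' A) := hX _ hA
  have hgint : Integrable (fun ω => (transition F ρ τ t (X s ω)).real A) μ := by
    refine Integrable.of_bound (hg.mono hle le_rfl).aestronglyMeasurable 1 (ae_of_all _ fun ω => ?_)
    rw [Real.norm_of_nonneg measureReal_nonneg]
    exact measureReal_le_one
  refine (ae_eq_condExp_of_forall_setIntegral_eq hle ((integrable_const 1).indicator hXA)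
    (fun H _ _ => hgint.integrableOn) (fun H hH _ => ?_) hg.aestronglyMeasurable).symm
  have key := measure_inter_path ρ hF hτ hψ hf s t hH hA
  rw [setIntegral_indicator hXA, setIntegral_const, smul_eq_mul, mul_one, Measure.real]
  change _ = (μ (H ∩ {ω | path F (s + t) (f (ψ ω).1) (ψ ω).2 ∈ A})).toReal
  rw [key]
  exact integral_toReal ((hP.comp (hX s)).aemeasurable)
    (ae_of_all _ fun ω => measure_lt_top _ _)

theorem tendsto_one_sub_exp_div (lam : ℝ) :
    Tendsto (fun h : ℝ≥0 => (1 - Real.exp (-(lam * h))) / (h : ℝ)) (𝓝[>] 0) (𝓝 lam) := by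
  have h1 : HasDerivAt (fun x : ℝ => 1 - Real.exp (-(lam * x))) lam 0 := by
    have := ((((hasDerivAt_id (0 : ℝ)).const_mul lam).neg).exp).const_sub 1
    simpa using this
  have h2 : Tendsto (fun h : ℝ≥0 => (h : ℝ)) (𝓝[>] 0) (𝓝[≠] 0) := by
    refine tendsto_nhdsWithin_iff.2 ⟨?_, ?_⟩
    · have : Tendsto (fun h : ℝ≥0 => (h : ℝ)) (𝓝 0) (𝓝 ((0 : ℝ≥0) : ℝ)) :=
        NNReal.continuous_coe.tendsto 0
      exact (this.mono_left nhdsWithin_le_nhds)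
    · filter_upwards [self_mem_nhdsWithin] with h hh
      have : (0 : ℝ≥0) < h := hh
      simpa using this.ne'
  have h3 := h1.tendsto_slope.comp h2
  refine h3.congr fun h => ?_
  simp [slope, div_eq_inv_mul]

open Classical in
/-- Up to an error of second order, the chain makes one step with probability `1 - exp(-lam h)` up
to time `h`, and no step otherwise. -/
theorem abs_transition_sub_le [MeasurableSingletonClass E]
    (hF : Measurable (Function.uncurry F)) (hτ : IsExponential lam τ) (h : ℝ≥0) (x y : E) :
    |(transition F ρ τ h x).real {y} - (if x = y then 1 else 0)
      - (1 - Real.exp (-(lam * h))) * (ρ.real {g | F x g = y} - if x = y then 1 else 0)|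
      ≤ (1 - Real.exp (-(lam * h))) ^ 2 := by
  set W := drivingLaw ρ τ with hW
  set e := Real.exp (-(lam * h)) with he
  set p := ρ.real {g | F x g = y} with hp
  have hFx : Measurable (F x) := hF.comp measurable_prodMk_left
  have hpm : MeasurableSet {g | F x g = y} := hFx (measurableSet_singleton y)
  have hPm : MeasurableSet {w | path F h x w = y} :=
    measurable_path_right hF h x (measurableSet_singleton y)
  have h0m : MeasurableSet {w : ℕ → G × ℝ≥0 | h < (w 0).2} :=
    measurableSet_lt measurable_const (by fun_prop)
  have h1m : MeasurableSet {w : ℕ → G × ℝ≥0 | h < (w 1).2} :=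
    measurableSet_lt measurable_const (by fun_prop)
  have hbox : ∀ S T : Set (G × ℝ≥0), MeasurableSet S → MeasurableSet T →
      W.real {w | w 0 ∈ S ∧ w 1 ∈ T} = (ρ.prod τ).real S * (ρ.prod τ).real T := by
    intro S T hS hT
    have hset : {w : ℕ → G × ℝ≥0 | w 0 ∈ S ∧ w 1 ∈ T}
        = Set.pi (({0, 1} : Finset ℕ) : Set ℕ) fun i => if i = 0 then S else T := by
      ext w
      simp
    rw [Measure.real, hset, hW, drivingLaw, Measure.infinitePi_pi]
    · simp [Measure.real]
    · intro i _
      split_ifs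
      exacts [hS, hT]
  -- If the first holding time exceeds `h` there is no jump; if only the second does, exactly one.
  -- The remaining event contains all cases of two or more jumps and has probability at most `(1 -
  -- e) ^ 2`.
  have hdec : W.real {w | path F h x w = y}
      = W.real {w | path F h x w = y ∧ h < (w 0).2}
        + (W.real {w | path F h x w = y ∧ (w 0).2 ≤ h ∧ h < (w 1).2}
        + W.real {w | path F h x w = y ∧ (w 0).2 ≤ h ∧ (w 1).2 ≤ h}) := by
    rw [← measureReal_inter_add_sdiff (s := {w | path F h x w = y}) h0m,
      ← measureReal_inter_add_sdiff (s := {w | path F h x w = y} \ _) h1m]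
    congr 2
    · congr 1
      ext w
      simp [and_assoc]
    · congr 1
      ext w
      simp [and_assoc]
  have hzero : W.real {w | path F h x w = y ∧ h < (w 0).2} = e * if x = y then 1 else 0 := by
    have hset : {w | path F h x w = y ∧ h < (w 0).2} = {w | x = y ∧ h < (w 0).2} := by
      ext w
      refine and_congr_left fun hw => ?_
      have : InStage h 0 w := ⟨by simp [jumpTime], by simpa [jumpTime] using hw⟩
      rw [path, this.jumpCount_eq, chain]
    rw [hset]
    by_cases hxy : x = y
    · simp only [hxy, true_and, if_true, mul_one]
      rw [Measure.real, drivingLaw_lt_zero ρ hτ, ENNReal.toReal_ofReal (Real.exp_pos _).le]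
    · simp [hxy]
  have hIic : τ.real (Set.Iic h) = 1 - e := hτ.real_Iic h
  have hIoi : τ.real (Set.Ioi h) = e := hτ.real_Ioi h
  have hone : W.real {w | path F h x w = y ∧ (w 0).2 ≤ h ∧ h < (w 1).2} = p * (1 - e) * e := by
    have hset : {w | path F h x w = y ∧ (w 0).2 ≤ h ∧ h < (w 1).2}
        = {w | w 0 ∈ {g | F x g = y} ×ˢ Set.Iic h ∧ w 1 ∈ Set.univ ×ˢ Set.Ioi h} := by
      ext w
      simp only [Set.mem_ofPred_eq, Set.mem_prod, Set.mem_Iic, Set.mem_univ, Set.mem_Ioi, true_and,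
        and_assoc]
      refine and_congr_left fun hw => ?_
      have : InStage h 1 w :=
        ⟨by simpa [jumpTime] using hw.1, by
          simp only [jumpTime, Finset.sum_range_succ, Finset.sum_range_zero, zero_add]
          exact hw.2.trans_le le_add_self⟩
      rw [path, this.jumpCount_eq, chain, chain]
    rw [hset, hbox _ _ (hpm.prod measurableSet_Iic) (MeasurableSet.univ.prod measurableSet_Ioi),
      measureReal_prod_prod, measureReal_prod_prod, hIic, hIoi]
    simp [hp]
  have hrest : W.real {w | path F h x w = y ∧ (w 0).2 ≤ h ∧ (w 1).2 ≤ h} ≤ (1 - e) ^ 2 := by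
    have hle : W.real {w | path F h x w = y ∧ (w 0).2 ≤ h ∧ (w 1).2 ≤ h}
        ≤ W.real {w | w 0 ∈ Set.univ ×ˢ Set.Iic h ∧ w 1 ∈ Set.univ ×ˢ Set.Iic h} :=
      measureReal_mono fun w hw => by simpa using hw.2
    refine hle.trans_eq ?_
    rw [hbox _ _ (MeasurableSet.univ.prod measurableSet_Iic)
      (MeasurableSet.univ.prod measurableSet_Iic), measureReal_prod_prod, hIic]
    simp [sq]
  have hP : (transition F ρ τ h x).real {y} = W.real {w | path F h x w = y} := by
    rw [Measure.real, transition_apply ρ hF h x (measurableSet_singleton y)]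
    rfl
  rw [hP, hdec, hzero, hone]
  set r := W.real {w | path F h x w = y ∧ (w 0).2 ≤ h ∧ (w 1).2 ≤ h}
  set δ : ℝ := if x = y then 1 else 0
  have hr : 0 ≤ r := measureReal_nonneg
  have hp0 : 0 ≤ p := measureReal_nonneg
  have hp1 : p ≤ 1 := measureReal_le_one
  have hre : e * δ + (p * (1 - e) * e + r) - δ - (1 - e) * (p - δ) = r - p * (1 - e) ^ 2 := by
    ring
  rw [hre, abs_le]
  constructor
  · nlinarith [mul_le_mul_of_nonneg_right hp1 (sq_nonneg (1 - e))]
  · nlinarith [mul_nonneg hp0 (sq_nonneg (1 - e))]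

open Classical in
/-- The transition rates of the continuous-time chain. -/
theorem hasRates_transition [MeasurableSingletonClass E]
    (hF : Measurable (Function.uncurry F)) (hτ : IsExponential lam τ) {Q : Matrix E E ℝ}
    (hQ : ∀ x y, Q x y = lam * (ρ.real {g | F x g = y} - if x = y then 1 else 0)) :
    HasRates (transition F ρ τ) Q := by
  intro x y
  set d : ℝ := ρ.real {g | F x g = y} - if x = y then 1 else 0 with hd
  have hlim := tendsto_one_sub_exp_div lam
  have hzero : Tendsto (fun h : ℝ≥0 => 1 - Real.exp (-(lam * h))) (𝓝[>] 0) (𝓝 0) := by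
    have : Continuous fun h : ℝ≥0 => 1 - Real.exp (-(lam * h)) := by fun_prop
    simpa using (this.tendsto 0).mono_left nhdsWithin_le_nhds
  have herr : Tendsto (fun h : ℝ≥0 => ((transition F ρ τ h x).real {y} - (if x = y then 1 else 0)
      - (1 - Real.exp (-(lam * h))) * d) / (h : ℝ)) (𝓝[>] 0) (𝓝 0) := by
    have hsq : Tendsto (fun h : ℝ≥0 => (1 - Real.exp (-(lam * h)))
        * ((1 - Real.exp (-(lam * h))) / (h : ℝ))) (𝓝[>] 0) (𝓝 0) := by
      simpa using hzero.mul hlim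
    refine squeeze_zero_norm (fun h => ?_) hsq
    rw [norm_div, Real.norm_eq_abs, Real.norm_of_nonneg h.coe_nonneg, ← mul_div_assoc, ← sq]
    exact div_le_div_of_nonneg_right (abs_transition_sub_le ρ hF hτ h x y) h.coe_nonneg
  have hsum := herr.add (hlim.mul_const d)
  rw [zero_add] at hsum
  rw [hQ x y]
  refine hsum.congr fun h => ?_
  ring

end UniformizedChain

/-! ### Counting the colourings that generate a partition -/

namespace PartitionK

variable {α : Type*} {k : ℕ}

theorem ofColours_eq_iff {c : α → Fin k} {B : PartitionK α k} :
    ofColours c = B ↔ ∀ i j, c i = c j ↔ B.1 i j := by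
  constructor
  · rintro rfl i j
    exact Iff.rfl
  · exact fun h => Subtype.ext (Setoid.ext h)

theorem ofColours_comp_perm (σ : Equiv.Perm (Fin k)) (c : α → Fin k) :
    ofColours (fun i => σ (c i)) = ofColours c :=
  ofColours_eq_iff.2 fun _ _ => σ.injective.eq_iff

theorem numBlocks_eq_card (B : PartitionK α k) : B.numBlocks = Nat.card (Quotient B.1) :=
  Nat.card_congr (Setoid.quotientEquivClasses B.1).symm

theorem numBlocks_le (B : PartitionK α k) : B.numBlocks ≤ k := by
  have h : B.1.classes.encard ≤ k := B.2
  have hfin : B.1.classes.Finite := Set.finite_of_encard_le_coe h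
  rw [← hfin.cast_ncard_eq] at h
  exact_mod_cast h

/-- Colourings that generate the same partition differ by a permutation of the colours. -/
theorem exists_perm_of_ofColours_eq {c c' : α → Fin k} (h : ofColours c = ofColours c') :
    ∃ σ : Equiv.Perm (Fin k), ∀ i, σ (c i) = c' i := by
  have hker : ∀ i j, c i = c j ↔ c' i = c' j := ofColours_eq_iff.1 h
  let f : Quotient (Setoid.ker c) → Fin k := Quotient.lift c fun _ _ hij => hij
  let f' : Quotient (Setoid.ker c) → Fin k := Quotient.lift c' fun i j hij => (hker i j).1 hij
  have hf : Function.Injective f := by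
    rintro ⟨i⟩ ⟨j⟩ hij
    exact Quotient.sound hij
  have hf' : Function.Injective f' := by
    rintro ⟨i⟩ ⟨j⟩ hij
    exact Quotient.sound ((hker i j).2 hij)
  -- The bijection between the colours used by `c` and those used by `c'` extends to a permutation
  -- because the colour set is finite.
  let e : {x // x ∈ Set.range f} ≃ {x // x ∈ Set.range f'} :=
    (Equiv.ofInjective f hf).symm.trans (Equiv.ofInjective f' hf')
  classical
  refine ⟨e.extendSubtype, fun i => ?_⟩
  rw [e.extendSubtype_apply_of_mem (c i) ⟨Quotient.mk _ i, rfl⟩]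
  have : (⟨c i, ⟨Quotient.mk _ i, rfl⟩⟩ : {x // x ∈ Set.range f})
      = Equiv.ofInjective f hf (Quotient.mk _ i) := rfl
  rw [this]
  simp [e, f']

/-- The colourings that generate a given partition are the injective colourings of its blocks. -/
def colouringEquiv (B : PartitionK α k) :
    {c : α → Fin k // ofColours c = B} ≃ (Quotient B.1 ↪ Fin k) where
  toFun c := ⟨Quotient.lift c.1 fun i j hij => (ofColours_eq_iff.1 c.2 i j).2 hij, by
    rintro ⟨i⟩ ⟨j⟩ hij
    exact Quotient.sound ((ofColours_eq_iff.1 c.2 i j).1 hij)⟩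
  invFun e := ⟨fun i => e (Quotient.mk _ i), ofColours_eq_iff.2 fun _ _ =>
    e.injective.eq_iff.trans Quotient.eq⟩
  left_inv _ := rfl
  right_inv e := by
    ext ⟨i⟩
    rfl

theorem card_colouring [Finite α] (B : PartitionK α k) :
    Nat.card {c : α → Fin k // ofColours c = B} = k.descFactorial B.numBlocks := by
  classical
  have := Fintype.ofFinite α
  have := Fintype.ofFinite (Quotient B.1)
  rw [Nat.card_congr B.colouringEquiv, Nat.card_eq_fintype_card, Fintype.card_embedding_eq,
    numBlocks_eq_card, Nat.card_eq_fintype_card, Fintype.card_fin]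

theorem descFactorial_eq_div {m : ℕ} (h : m ≤ k) :
    (k.descFactorial m : ℝ) = (k ! : ℝ) / ((k - m)! : ℝ) := by
  rw [eq_div_iff (by exact_mod_cast (k - m).factorial_ne_zero), mul_comm]
  exact_mod_cast Nat.factorial_mul_descFactorial h

end PartitionK

/-! ### Mixed and shuffled colour sequences -/

section Paintbox

variable {k : ℕ}

open PartitionK

/-- The law of i.i.d. colours with law `s`. -/
noncomputable def iidColours (s : RankedSimplex k) : Measure (ℕ → Fin k) :=
  Measure.infinitePi fun _ : ℕ => (colourLaw s).toMeasure

instance (s : RankedSimplex k) : IsProbabilityMeasure (iidColours s) := by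
  unfold iidColours
  infer_instance

/-- The probability of a box is a polynomial in the coordinates of `s`, and boxes form a generating
π-system. This makes the mixture over `ν` a well-behaved `Measure.bind`. -/
theorem measurable_iidColours :
    Measurable (iidColours : RankedSimplex k → Measure (ℕ → Fin k)) := by
  refine Measurable.measure_of_isPiSystem_of_isProbabilityMeasure
    generateFrom_squareCylinders.symm
    (isPiSystem_squareCylinders (fun _ => MeasurableSpace.isPiSystem_measurableSet)
      fun _ => Set.mem_ofPred_eq ▸ MeasurableSet.univ) ?_
  rintro _ ⟨I, t, ht, rfl⟩
  have htm : ∀ i, MeasurableSet (t i) := fun _ => trivial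
  have h : ∀ s : RankedSimplex k, iidColours s (Set.pi I t)
      = ∏ i ∈ I, ∑ j, (t i).indicator (fun j => ENNReal.ofReal (s.1 j)) j := fun s => by
    rw [iidColours, Measure.infinitePi_pi _ fun i _ => htm i]
    refine Finset.prod_congr rfl fun i _ => ?_
    rw [PMF.toMeasure_apply_fintype]
    rfl
  simp only [h]
  refine Finset.measurable_prod _ fun i _ => Finset.measurable_sum _ fun j _ => ?_
  by_cases hj : j ∈ t i
  · simp only [Set.indicator_of_mem hj]
    exact ENNReal.measurable_ofReal.comp ((measurable_pi_apply j).comp measurable_subtype_coe)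
  · simp only [Set.indicator_of_notMem hj]
    exact measurable_const

/-- The law of colours that are i.i.d. given their random distribution, which has law `ν`. -/
noncomputable def mixedColours (ν : Measure (RankedSimplex k)) : Measure (ℕ → Fin k) :=
  ν.bind iidColours

variable (ν : Measure (RankedSimplex k)) [IsProbabilityMeasure ν]

instance : IsProbabilityMeasure (mixedColours ν) :=
  ⟨by rw [mixedColours, Measure.bind_apply .univ measurable_iidColours.aemeasurable]; simp⟩

theorem paintboxMix_eq (ν : Measure (RankedSimplex k)) {E : Set (PartitionK ℕ k)}
    (hE : MeasurableSet E) : paintboxMix ν E = mixedColours ν (ofColours ⁻¹' E) := by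
  rw [mixedColours, Measure.bind_apply (measurable_ofColours hE) measurable_iidColours.aemeasurable,
    paintboxMix]
  refine lintegral_congr fun s => ?_
  rw [paintbox, Measure.map_apply measurable_ofColours hE]
  rfl

theorem paintboxProb_eq {n : ℕ} (ν : Measure (RankedSimplex k)) (b : Set (Fin n))
    (π : PartitionK b k) :
    paintboxProb ν b π = (mixedColours ν).real {x | ofColours (fun i : b => x i.1) = π} := by
  have hE : MeasurableSet {C : PartitionK ℕ k | (C.restrict n).restrictTo b = π} :=
    measurable_restrict n (t := {D | D.restrictTo b = π}) trivial
  rw [paintboxProb, paintboxMix_eq ν hE]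
  rfl

/-- The law of exchangeable random colours, whose labels are permuted uniformly at random. -/
noncomputable def shuffledColours (ν : Measure (RankedSimplex k)) : Measure (ℕ → Fin k) :=
  (k ! : ℝ≥0∞)⁻¹ • ∑ σ : Equiv.Perm (Fin k), (mixedColours ν).map fun x i => σ (x i)

theorem measurable_relabel (σ : Equiv.Perm (Fin k)) :
    Measurable fun (x : ℕ → Fin k) (i : ℕ) => σ (x i) :=
  measurable_pi_lambda _ fun i => (measurable_of_finite σ).comp (measurable_pi_apply i)

theorem shuffledColours_apply (ν : Measure (RankedSimplex k)) {E : Set (ℕ → Fin k)}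
    (hE : MeasurableSet E) :
    shuffledColours ν E
      = (k ! : ℝ≥0∞)⁻¹ * ∑ σ : Equiv.Perm (Fin k), mixedColours ν {x | (fun i => σ (x i)) ∈ E} := by
  simp only [shuffledColours, Measure.smul_apply, Measure.finsetSum_apply, smul_eq_mul]
  congr 1
  refine Finset.sum_congr rfl fun σ _ => ?_
  rw [Measure.map_apply (measurable_relabel σ) hE]
  rfl

/-- Events that do not depend on the labels of the colours. -/
theorem shuffledColours_eq_mixedColours (ν : Measure (RankedSimplex k)) {E : Set (ℕ → Fin k)}
    (hE : MeasurableSet E)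
    (hinv : ∀ (σ : Equiv.Perm (Fin k)) x, (fun i => σ (x i)) ∈ E ↔ x ∈ E) :
    shuffledColours ν E = mixedColours ν E := by
  rw [shuffledColours_apply ν hE]
  have : ∀ σ : Equiv.Perm (Fin k), {x | (fun i => σ (x i)) ∈ E} = E := fun σ => by
    ext x
    exact hinv σ x
  simp only [this, Finset.sum_const, Finset.card_univ, Fintype.card_perm, Fintype.card_fin,
    nsmul_eq_mul]
  rw [← mul_assoc, ENNReal.inv_mul_cancel (by exact_mod_cast k.factorial_ne_zero)
    (ENNReal.natCast_ne_top _), one_mul]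

instance : IsProbabilityMeasure (shuffledColours ν) :=
  ⟨by rw [shuffledColours_eq_mixedColours ν .univ (by simp), measure_univ]⟩

/-- Left multiplication by `σ` only reorders the sum over all permutations. -/
theorem shuffledColours_relabel (ν : Measure (RankedSimplex k)) (σ : Equiv.Perm (Fin k))
    {E : Set (ℕ → Fin k)} (hE : MeasurableSet E) :
    shuffledColours ν {x | (fun i => σ (x i)) ∈ E} = shuffledColours ν E := by
  have hE' : MeasurableSet {x : ℕ → Fin k | (fun i => σ (x i)) ∈ E} := measurable_relabel σ hE
  rw [shuffledColours_apply ν hE, shuffledColours_apply ν hE']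
  congr 1
  exact Fintype.sum_equiv (Equiv.mulLeft σ) _ _ fun _ => rfl

variable {α : Type*} [Finite α] (v : α → ℕ)

theorem measurableSet_colours (c : α → Fin k) :
    MeasurableSet {x : ℕ → Fin k | ∀ i, x (v i) = c i} := by
  have : {x : ℕ → Fin k | ∀ i, x (v i) = c i} = ⋂ i, {x | x (v i) = c i} := by
    ext x
    simp
  rw [this]
  exact MeasurableSet.iInter fun i =>
    measurableSet_eq_fun (measurable_pi_apply (v i)) measurable_const

theorem measure_ofColours_eq_sum {Ξ : Type*} [MeasurableSpace Ξ] (μ : Measure Ξ)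
    [IsProbabilityMeasure μ] {X : Ξ → α → Fin k} (hX : Measurable X) (B : PartitionK α k) :
    μ.real {ξ | ofColours (X ξ) = B}
      = ∑ᶠ c : {c : α → Fin k // ofColours c = B}, μ.real {ξ | X ξ = c.1} := by
  have := Fintype.ofFinite {c : α → Fin k // ofColours c = B}
  have hset : {ξ | ofColours (X ξ) = B}
      = ⋃ c ∈ (Finset.univ : Finset {c : α → Fin k // ofColours c = B}), {ξ | X ξ = c.1} := by
    ext ξ
    simp
  rw [hset, finsum_eq_sum_of_fintype, measureReal_biUnion_finset]
  · intro c _ c' _ hne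
    refine Set.disjoint_left.2 fun ξ h h' => hne (Subtype.ext ?_)
    exact (show X ξ = c.1 from h).symm.trans h'
  · exact fun c _ => hX (measurableSet_singleton c.1)

/-- The probability that shuffled colours take given values. -/
theorem shuffledColours_real (c : α → Fin k) {π : PartitionK α k} (hc : ofColours c = π) :
    (shuffledColours ν).real {x | ∀ i, x (v i) = c i}
      = ((k - π.numBlocks)! : ℝ) / (k ! : ℝ)
        * (mixedColours ν).real {x | ofColours (fun i => x (v i)) = π} := by
  have hX : Measurable fun (x : ℕ → Fin k) (i : α) => x (v i) := by fun_prop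
  have hE : MeasurableSet {x : ℕ → Fin k | ofColours (fun i => x (v i)) = π} :=
    hX (t := {d | ofColours d = π}) (Set.toFinite _).measurableSet
  have h1 : (mixedColours ν).real {x | ofColours (fun i => x (v i)) = π}
      = (shuffledColours ν).real {x | ofColours (fun i => x (v i)) = π} := by
    rw [Measure.real, Measure.real, shuffledColours_eq_mixedColours ν hE]
    intro σ x
    exact iff_of_eq (congrArg (· = π) (ofColours_comp_perm σ fun i => x (v i)))
  -- All colourings generating `π` differ by a permutation of colours, so they are equally likely;
  -- each probability is the total divided by their number.
  have h2 : ∀ d : {d : α → Fin k // ofColours d = π},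
      (shuffledColours ν).real {x | (fun i => x (v i)) = d.1}
        = (shuffledColours ν).real {x | ∀ i, x (v i) = c i} := fun d => by
    obtain ⟨σ, hσ⟩ := exists_perm_of_ofColours_eq (hc.trans d.2.symm)
    have hset : {x : ℕ → Fin k | ∀ i, x (v i) = c i}
        = {x | (fun i => σ (x i)) ∈ {x : ℕ → Fin k | ∀ i, x (v i) = d.1 i}} := by
      ext x
      simp only [Set.mem_ofPred_eq, ← hσ, σ.injective.eq_iff]
    rw [hset, Measure.real, Measure.real,
      shuffledColours_relabel ν σ (measurableSet_colours v d.1)]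
    simp only [funext_iff]
  rw [h1, measure_ofColours_eq_sum _ hX π, finsum_congr h2]
  have := Fintype.ofFinite {c : α → Fin k // ofColours c = π}
  rw [finsum_eq_sum_of_fintype, Finset.sum_const, Finset.card_univ, ← Nat.card_eq_fintype_card,
    card_colouring, nsmul_eq_mul, descFactorial_eq_div π.numBlocks_le]
  have h3 : (k ! : ℝ) ≠ 0 := by exact_mod_cast k.factorial_ne_zero
  have h4 : ((k - π.numBlocks)! : ℝ) ≠ 0 := by exact_mod_cast (k - π.numBlocks).factorial_ne_zero
  field_simp

end Paintbox

/-! ### The recolouring step -/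

namespace PartitionK

variable {α : Type*} {k : ℕ}

/-- The least label of an element of the block of `i`, for the labels `v`. -/
noncomputable def leader (v : α → ℕ) (B : PartitionK α k) (i : α) : ℕ := sInf (v '' {j | B.1 j i})

/-- Split each block of `B` according to the colours of its own sequence of colours, and merge all
elements with the same colour. -/
noncomputable def recolour (v : α → ℕ) (B : PartitionK α k) (ξ : ℕ → ℕ → Fin k) : PartitionK α k :=
  ofColours fun i => ξ (leader v B i) (v i)

theorem leader_eq_iff {v : α → ℕ} (hv : Function.Injective v) (B : PartitionK α k) {i j : α} :
    leader v B i = leader v B j ↔ B.1 i j := by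
  have hmem : ∀ i, ∃ a, B.1 a i ∧ v a = leader v B i := fun i =>
    Nat.sInf_mem (s := v '' {j | B.1 j i}) ⟨v i, i, B.1.refl' i, rfl⟩
  constructor
  · intro h
    obtain ⟨a, ha, hai⟩ := hmem i
    obtain ⟨b, hb, hbj⟩ := hmem j
    have hab : a = b := hv (hai.trans (h.trans hbj.symm))
    exact B.1.trans' (B.1.symm' ha) (hab ▸ hb)
  · intro h
    have : {a | B.1 a i} = {a | B.1 a j} :=
      Set.ext fun a => ⟨fun ha => B.1.trans' ha h, fun ha => B.1.trans' ha (B.1.symm' h)⟩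
    rw [leader, leader, this]

/-- The least element of the block of `i` is at most `i < n`, so restriction keeps it. This is why
blocks are named by their least elements. -/
theorem leader_restrict {n : ℕ} (B : PartitionK ℕ k) (i : Fin n) :
    leader Fin.val (B.restrict n) i = leader id B i.1 := by
  have hne : (id '' {j | B.1 j i.1}).Nonempty := ⟨i.1, i.1, B.1.refl' _, rfl⟩
  have hle : leader id B i.1 ≤ i.1 := Nat.sInf_le ⟨i.1, B.1.refl' _, rfl⟩
  obtain ⟨a, ha, hai⟩ : ∃ a, B.1 a i.1 ∧ id a = leader id B i.1 := Nat.sInf_mem hne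
  refine le_antisymm (Nat.sInf_le ⟨⟨leader id B i.1, hle.trans_lt i.2⟩, ?_, rfl⟩) ?_
  · change B.1 (leader id B i.1) i.1
    rw [← hai]
    exact ha
  · refine le_csInf ⟨i.1, i, B.1.refl' _, rfl⟩ ?_
    rintro _ ⟨j, hj, rfl⟩
    exact Nat.sInf_le ⟨j.1, hj, rfl⟩

theorem restrict_recolour (n : ℕ) (B : PartitionK ℕ k) (ξ : ℕ → ℕ → Fin k) :
    (recolour id B ξ).restrict n = recolour Fin.val (B.restrict n) ξ := by
  symm
  refine ofColours_eq_iff.2 fun i j => ?_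
  rw [leader_restrict, leader_restrict]
  rfl

instance (n : ℕ) : MeasurableSingletonClass (PartitionK (Fin n) k) := ⟨fun _ => trivial⟩

instance (n : ℕ) : Finite (PartitionK (Fin n) k) :=
  Finite.of_injective (fun B : PartitionK (Fin n) k => fun i j => B.1 i j) fun _ _ h =>
    Subtype.ext (Setoid.ext fun i j => iff_of_eq (congrFun (congrFun h i) j))

theorem measurable_colour {Ξ : Type*} [MeasurableSpace Ξ] {L : Ξ → ℕ} (hL : Measurable L)
    {Z : Ξ → ℕ → ℕ → Fin k} (hZ : Measurable Z) (i : ℕ) : Measurable fun p => Z p (L p) i := by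
  have h : Measurable fun q : ℕ × (ℕ → ℕ → Fin k) => q.2 q.1 i :=
    measurable_from_prod_countable_right fun m => by fun_prop
  exact h.comp (hL.prodMk hZ)

/-- The leader of `i` is a function of the restriction to the first `i + 1` labels, which takes
finitely many values. -/
theorem measurable_recolour_nat :
    Measurable (Function.uncurry (recolour id : PartitionK ℕ k → (ℕ → ℕ → Fin k) → _)) := by
  refine measurable_ofColours.comp (measurable_pi_lambda _ fun i => ?_)
  have hL : Measurable fun B : PartitionK ℕ k => leader id B i := by
    have h : (fun B : PartitionK ℕ k => leader id B i)
        = (fun D : PartitionK (Fin (i + 1)) k => leader Fin.val D (Fin.last i)) ∘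
          restrict (i + 1) :=
      funext fun B => (leader_restrict B (Fin.last i)).symm
    rw [h]
    exact (measurable_of_finite _).comp (measurable_restrict _)
  exact measurable_colour (hL.comp measurable_fst) measurable_snd i

theorem measurable_recolour_fin (n : ℕ) :
    Measurable (Function.uncurry
      (recolour Fin.val : PartitionK (Fin n) k → (ℕ → ℕ → Fin k) → _)) := by
  have h : Measurable (ofColours : (Fin n → Fin k) → PartitionK (Fin n) k) :=
    measurable_of_finite _
  exact h.comp (measurable_pi_lambda _ fun i =>
    measurable_colour ((measurable_of_finite fun B => leader Fin.val B i).comp measurable_fst)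
      measurable_snd i)

/-- One recolouring step has the transition probabilities `transProb`. -/
theorem infinitePi_recolour (ν : Measure (RankedSimplex k)) [IsProbabilityMeasure ν] (n : ℕ)
    (B B' : PartitionK (Fin n) k) :
    (Measure.infinitePi fun _ : ℕ => shuffledColours ν).real {ξ | recolour Fin.val B ξ = B'}
      = transProb ν n B B' := by
  classical
  set ρ := Measure.infinitePi fun _ : ℕ => shuffledColours ν with hρ
  let L : Fin n → ℕ := leader Fin.val B
  let block : ℕ → Set (Fin n) := fun m => {i | L i = m}
  let I : Finset ℕ := Finset.univ.image L
  let q : Set (Fin n) → ℝ := fun b =>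
    (((k - (B'.restrictTo b).numBlocks)! : ℝ) / (k ! : ℝ)) * paintboxProb ν b (B'.restrictTo b)
  have hX : Measurable fun (ξ : ℕ → ℕ → Fin k) (i : Fin n) => ξ (L i) i := by fun_prop
  have hblocks : B.blocks = block '' (I : Set ℕ) := by
    ext b
    constructor
    · rintro ⟨i, rfl⟩
      refine ⟨L i, by simp [I], ?_⟩
      ext j
      exact leader_eq_iff Fin.val_injective B
    · rintro ⟨m, hm, rfl⟩
      obtain ⟨i, -, rfl⟩ := Finset.mem_image.1 (Finset.mem_coe.1 hm)
      refine ⟨i, ?_⟩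
      ext j
      exact leader_eq_iff Fin.val_injective B
  have hinj : Set.InjOn block (I : Set ℕ) := by
    intro m hm m' _ h
    obtain ⟨i, -, rfl⟩ := Finset.mem_image.1 (Finset.mem_coe.1 hm)
    have : i ∈ block m' := h ▸ (rfl : L i = L i)
    exact this
  have hprod : ∏ᶠ b ∈ B.blocks, q b = ∏ m ∈ I, q (block m) := by
    rw [hblocks, finprod_mem_image hinj, finprod_mem_coe_finset]
  -- Distinct blocks read distinct, hence independent, sequences, so the probability of a colouring
  -- factorises. The product depends on `c` only through `B'`, so summing over `c` amounts to
  -- multiplying by the number of colourings.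
  have hcol : ∀ c : {c : Fin n → Fin k // ofColours c = B'},
      ρ.real {ξ | (fun i => ξ (L i) i) = c.1} = ∏ m ∈ I, q (block m) := by
    intro c
    have hset : {ξ : ℕ → ℕ → Fin k | (fun i : Fin n => ξ (L i) i) = c.1}
        = Set.pi (I : Set ℕ) fun m => {x | ∀ i : block m, x i.1 = c.1 i.1} := by
      ext ξ
      simp only [funext_iff, Set.mem_ofPred_eq, Set.mem_pi, Finset.mem_coe, I, Finset.mem_image,
        Finset.mem_univ, true_and, forall_exists_index, forall_apply_eq_imp_iff, Subtype.forall,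
        block]
      exact ⟨fun h i j hj => hj ▸ h j, fun h i => h i i rfl⟩
    rw [Measure.real, hset, hρ, Measure.infinitePi_pi _ fun m _ =>
      measurableSet_colours (fun i : block m => (i.1 : ℕ)) fun i => c.1 i.1, ENNReal.toReal_prod]
    refine Finset.prod_congr rfl fun m _ => ?_
    have hc : ofColours (fun i : block m => c.1 i.1) = B'.restrictTo (block m) :=
      congrArg (fun D : PartitionK (Fin n) k => D.restrictTo (block m)) c.2
    simp only [q]
    rw [paintboxProb_eq]
    exact shuffledColours_real ν (fun i : block m => (i.1 : ℕ)) (fun i => c.1 i.1) hc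
  have := Fintype.ofFinite {c : Fin n → Fin k // ofColours c = B'}
  have hsum := measure_ofColours_eq_sum ρ hX B'
  rw [finsum_congr hcol, finsum_eq_sum_of_fintype, Finset.sum_const, Finset.card_univ,
    ← Nat.card_eq_fintype_card, card_colouring, nsmul_eq_mul,
    descFactorial_eq_div B'.numBlocks_le, ← hprod] at hsum
  exact hsum

end PartitionK

/-! ### Construction of the process -/

theorem theorem3 (k : ℕ) (ν : Measure (RankedSimplex k)) [IsProbabilityMeasure ν]
    (lam : ℝ) (hlam : 0 < lam) :
    ∃ P : ℝ≥0 → Kernel (PartitionK ℕ k) (PartitionK ℕ k), IsMarkovSemigroup P ∧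
      ∀ (μ₀ : Measure (PartitionK ℕ k)) [IsProbabilityMeasure μ₀],
        ∃ (Ω : Type) (_ : MeasurableSpace Ω) (μ : Measure Ω) (B : ℝ≥0 → Ω → PartitionK ℕ k),
          IsProbabilityMeasure μ ∧
          IsMarkovProcess P B μ ∧
          μ.map (B 0) = μ₀ ∧
          (∀ ω, IsCadlag fun t => B t ω) ∧
          ∀ n : ℕ, IsMarkovProcessWithQMatrix (rateMatrix lam ν n)
            (fun t ω => (B t ω).restrict n) μ := by
  classical
  obtain ⟨τ, _, hτ⟩ := UniformizedChain.exists_isExponential hlam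
  let ρ : Measure (ℕ → ℕ → Fin k) := Measure.infinitePi fun _ : ℕ => shuffledColours ν
  have hF := PartitionK.measurable_recolour_nat (k := k)
  refine ⟨UniformizedChain.transition (PartitionK.recolour id) ρ τ,
    UniformizedChain.isMarkovSemigroup_transition ρ hF hτ, fun μ₀ _ => ?_⟩
  let W := UniformizedChain.drivingLaw ρ τ
  -- Taking the full-measure set of non-explosive sequences as the sample space makes every path
  -- càdlàg, not only almost every one.
  let good : Set (PartitionK ℕ k × (ℕ → (ℕ → ℕ → Fin k) × ℝ≥0)) :=
    {p | UniformizedChain.NonExplosive p.2}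
  have hgood : MeasurableSet good :=
    measurable_snd UniformizedChain.measurableSet_nonExplosive
  have hae : ∀ᵐ p ∂μ₀.prod W, p ∈ good :=
    Measure.quasiMeasurePreserving_snd.ae (UniformizedChain.ae_nonExplosive ρ hτ)
  have hψ : MeasurePreserving (Subtype.val : good → _)
      ((μ₀.prod W).comap Subtype.val) (μ₀.prod W) :=
    ⟨measurable_subtype_coe, by
      rw [map_comap_subtype_coe hgood, Measure.restrict_eq_self_of_ae_mem hae]⟩
  have hprob : IsProbabilityMeasure ((μ₀.prod W).comap (Subtype.val : good → _)) :=
    ⟨by rw [← Set.preimage_univ, hψ.measure_preimage MeasurableSet.univ.nullMeasurableSet,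
      measure_univ]⟩
  refine ⟨good, inferInstance, (μ₀.prod W).comap Subtype.val,
    fun t ω => UniformizedChain.path (PartitionK.recolour id) t ω.1.1 ω.1.2, hprob,
    UniformizedChain.isMarkovProcess_path ρ hF hτ hψ measurable_id, ?_,
    fun ω => UniformizedChain.isCadlag_path _ _ ω.2, fun n => ?_⟩
  · have h0 : ∀ᵐ ω ∂(μ₀.prod W).comap (Subtype.val : good → _), 0 < (ω.1.2 0).2 :=
      hψ.quasiMeasurePreserving.ae
        (Measure.quasiMeasurePreserving_snd.ae (UniformizedChain.ae_pos_zero ρ hτ))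
    have hcongr : (fun ω : good => UniformizedChain.path (PartitionK.recolour id) 0 ω.1.1 ω.1.2)
        =ᵐ[(μ₀.prod W).comap Subtype.val] Prod.fst ∘ Subtype.val := by
      filter_upwards [h0] with ω hω
      exact UniformizedChain.path_zero _ _ hω
    rw [Measure.map_congr hcongr, ← Measure.map_map measurable_fst measurable_subtype_coe,
      hψ.map_eq]
    simp
  · have hFn := PartitionK.measurable_recolour_fin (k := k) n
    refine ⟨UniformizedChain.transition (PartitionK.recolour Fin.val) ρ τ,
      UniformizedChain.isMarkovSemigroup_transition ρ hFn hτ,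
      UniformizedChain.hasRates_transition ρ hFn hτ fun x y => ?_, ?_⟩
    · rw [PartitionK.infinitePi_recolour, rateMatrix]
      by_cases hxy : x = y
      · simp [hxy]
      · simp [hxy]
    -- The restricted process is the finite chain run from the restricted initial state with the
    -- same driving sequence.
    · simp only [UniformizedChain.map_path (PartitionK.restrict_recolour n)]
      exact UniformizedChain.isMarkovProcess_path ρ hFn hτ hψ (PartitionK.measurable_restrict n)
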